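/- Let $H$ be a complex Hilbert space, let $T$ be a normal operator on $H$ (closed, densely defined, $TT^*=T^*T$), possibly unbounded, and let $A$ be a linear operator on $H$ with $\mathcal D(T)\subseteq\mathcal D(A)$ and $$\|Ax\|^2\le a^2\|x\|^2+b^2\|Tx\|^2\qquad (x\in\mathcal D(T))$$ for constants $a\ge 0$, $0\le b<1$. The operator $T+A$ is defined on $\mathcal D(T)$. Write $\rho$ and $\sigma$ for resolvent set and spectrum. Let $\alpha<\beta$ and $\gamma_1\le\gamma_2$ be real numbers and define the gapped strip $$\mathrm{Str}=\{z\in\mathbb C:\operatorname{Re}z\in\mathbb R\setminus(\alpha,\beta),\ \gamma_1\le\operatorname{Im}z\le\gamma_2\}.$$ Assume $\sigma(T)=\Sigma_0\cup\Sigma_1$ with $\Sigma_0\subseteq\mathrm{Str}$ and $\Sigma_1=\{\lambda_1,\dots,\lambda_N\}$ a finite set of ($N$ distinct) eigenvalues of $T$, each of finite multiplicity $\dim\ker(T-\lambda_j)$, with $\Sigma_1\cap\mathrm{Str}=\emptyset$. Put $\widetilde\gamma=\max\{|\gamma_1|,|\gamma_2|\}$, $$\alpha'=\alpha+\sqrt{a^2+b^2\widetilde\gamma^2+b^2\alpha^2},\qquad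 \beta'=\beta-\sqrt{a^2+b^2\widetilde\gamma^2+b^2\beta^2},\qquad r_j=\sqrt{a^2+b^2|\lambda_j|^2},$$ $$\mathrm{Hyp}=\Big\{z\in\mathbb C:\ \frac{a^2+b^2\widetilde\gamma^2}{1-b^2}+\frac{b^2(\operatorname{Re}z)^2}{1-b^2}<(\operatorname{Im}z)^2,\ \operatorname{Im}z>0\Big\},$$ let $K_r(\lambda)$ denote the closed disk of radius $r$ centred at $\lambda$, and set $$U=\{z:\alpha'<\operatorname{Re}z<\beta'\}\cup(\mathrm i\gamma_1-\mathrm{Hyp})\cup(\mathrm i\gamma_2+\mathrm{Hyp}),\qquad V=\{z:\alpha'\le\operatorname{Re}z\le\beta'\}\cup(\mathrm i\gamma_1-\mathrm{Hyp})\cup(\mathrm i\gamma_2+\mathrm{Hyp}).$$ The algebraic multiplicity of an eigenvalue $\mu$ of an operator $S$ is $\dim\bigcup_{n}\ker(S-\mu)^n$. Then: (i) $U\setminus\bigcup_{j=1}^N K_{r_j}(\lambda_j)\subseteq\rho(T+A)$. (ii) If for some $k\in\{1,\dots,N\}$ and some $\epsilon>0$ we have $K_{r_k+2\epsilon}(\lambda_k)\subseteq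 V\setminus\bigcup_{j\ne k}K_{r_j}(\lambda_j)$, then $\sigma(T+A)\cap K_{r_k}(\lambda_k)$ consists of finitely many eigenvalues of $T+A$ of finite algebraic multiplicity, and their total algebraic multiplicity equals the multiplicity $\dim\ker(T-\lambda_k)$ of $\lambda_k$ as an eigenvalue of $T$. (iii) If there is $\epsilon>0$ such that $K_{r_k+2\epsilon}(\lambda_k)\subseteq V\setminus\bigcup_{j\ne k}K_{r_j}(\lambda_j)$ for every $k\in\{1,\dots,N\}$, then $\sigma(T+A)\cap\bigcup_{j=1}^N K_{r_j}(\lambda_j)$ consists of finitely many eigenvalues of $T+A$ of finite algebraic multiplicity, and their total algebraic multiplicity equals $\sum_{j=1}^N\dim\ker(T-\lambda_j)$. -/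

import Mathlib

noncomputable section

namespace NormalPerturbation

variable {H : Type*} [NormedAddCommGroup H] [InnerProductSpace ℂ H]

/-- The product `S R` of two unbounded operators, on its natural domain
`{x ∈ D(R) : R x ∈ D(S)}`. -/
def prod (S R : H →ₗ.[ℂ] H) : H →ₗ.[ℂ] H :=
  S.comp (R.domRestrict ((S.domain.comap R.toFun).map R.domain.subtype)) (by
    rintro ⟨x, hx, hxR⟩
    obtain ⟨y, hy, rfl⟩ := hx
    exact hy)

/-- A normal operator: closed, densely defined, and `T T* = T* T`
(equality of unbounded operators, including their domains). -/
def IsNormal [CompleteSpace H] (T : H →ₗ.[ℂ] H) : Prop :=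
  T.IsClosed ∧ Dense (T.domain : Set H) ∧ prod T T.adjoint = prod T.adjoint T

/-- `D(T) ⊆ D(A)` and `‖A x‖² ≤ a² ‖x‖² + b² ‖T x‖²` for all `x ∈ D(T)`. -/
def IsRelBounded (T A : H →ₗ.[ℂ] H) (a b : ℝ) : Prop :=
  ∃ h : T.domain ≤ A.domain, ∀ x : T.domain,
    ‖A ⟨x, h x.2⟩‖ ^ 2 ≤ a ^ 2 * ‖(x : H)‖ ^ 2 + b ^ 2 * ‖T x‖ ^ 2

/-- The operator `S - z` on `D(S)`. -/
def shift (S : H →ₗ.[ℂ] H) (z : ℂ) : S.domain →ₗ[ℂ] H :=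
  S.toFun - z • S.domain.subtype

/-- The resolvent set of a closed operator: all `z` such that `S - z : D(S) → H` is bijective
(the inverse is then automatically bounded). -/
def resolventSet (S : H →ₗ.[ℂ] H) : Set ℂ :=
  {z | Function.Bijective (shift S z)}

/-- The spectrum, the complement of the resolvent set. -/
def spec (S : H →ₗ.[ℂ] H) : Set ℂ := (resolventSet S)ᶜ

/-- `ker (S - z)` as a subspace of `H`. -/
def eigenspace (S : H →ₗ.[ℂ] H) (z : ℂ) : Submodule ℂ H :=
  (LinearMap.ker (shift S z)).map S.domain.subtype

def IsEigenvalue (S : H →ₗ.[ℂ] H) (z : ℂ) : Prop := eigenspace S z ≠ ⊥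

/-- `ker ((S - z) ^ n)`, where the power has its natural domain: `x` belongs to
`ker ((S - z) ^ (n + 1))` iff `x ∈ D(S)` and `(S - z) x ∈ ker ((S - z) ^ n)`. -/
def kerPow (S : H →ₗ.[ℂ] H) (z : ℂ) : ℕ → Submodule ℂ H
  | 0 => ⊥
  | n + 1 => ((kerPow S z n).comap (shift S z)).map S.domain.subtype

/-- The root subspace (generalized eigenspace) `⋃ₙ ker ((S - z) ^ n)`.
Its dimension is the algebraic multiplicity of `z`. -/
def rootSpace (S : H →ₗ.[ℂ] H) (z : ℂ) : Submodule ℂ H := ⨆ n, kerPow S z n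

/-- `σ(S) ∩ K` consists of finitely many eigenvalues of `S`, each of finite algebraic
multiplicity, and the sum of these algebraic multiplicities is `m`. -/
def HasTotalAlgMult (S : H →ₗ.[ℂ] H) (K : Set ℂ) (m : ℕ) : Prop :=
  ∃ F : Finset ℂ, (F : Set ℂ) = spec S ∩ K ∧
    (∀ μ ∈ F, IsEigenvalue S μ ∧ FiniteDimensional ℂ (rootSpace S μ)) ∧
    ∑ μ ∈ F, Module.finrank ℂ (rootSpace S μ) = m

/-- The gapped strip. -/
def Str (α β γ₁ γ₂ : ℝ) : Set ℂ :=
  {z | z.re ∉ Set.Ioo α β ∧ γ₁ ≤ z.im ∧ z.im ≤ γ₂}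

/-- The set of points above the hyperbola. -/
def Hyp (a b γ : ℝ) : Set ℂ :=
  {z | (a ^ 2 + b ^ 2 * γ ^ 2) / (1 - b ^ 2) + b ^ 2 * z.re ^ 2 / (1 - b ^ 2) < z.im ^ 2 ∧
    0 < z.im}

def gammaTilde (γ₁ γ₂ : ℝ) : ℝ := max |γ₁| |γ₂|

/-- `α' = α + √(a² + b² γ̃² + b² α²)`. -/
def alphaPrime (a b α γ₁ γ₂ : ℝ) : ℝ :=
  α + √(a ^ 2 + b ^ 2 * gammaTilde γ₁ γ₂ ^ 2 + b ^ 2 * α ^ 2)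

/-- `β' = β - √(a² + b² γ̃² + b² β²)`. -/
def betaPrime (a b β γ₁ γ₂ : ℝ) : ℝ :=
  β - √(a ^ 2 + b ^ 2 * gammaTilde γ₁ γ₂ ^ 2 + b ^ 2 * β ^ 2)

/-- `(iγ₁ - Hyp_γ̃) ∪ (iγ₂ + Hyp_γ̃)`. -/
def hypRegion (a b γ₁ γ₂ : ℝ) : Set ℂ :=
  (fun w : ℂ => Complex.I * γ₁ - w) '' Hyp a b (gammaTilde γ₁ γ₂) ∪
    (fun w : ℂ => Complex.I * γ₂ + w) '' Hyp a b (gammaTilde γ₁ γ₂)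

/-- `{α' < Re z < β'} ∪ (iγ₁ - Hyp_γ̃) ∪ (iγ₂ + Hyp_γ̃)`. -/
def openRegion (a b α β γ₁ γ₂ : ℝ) : Set ℂ :=
  {z | alphaPrime a b α γ₁ γ₂ < z.re ∧ z.re < betaPrime a b β γ₁ γ₂} ∪ hypRegion a b γ₁ γ₂

/-- `{α' ≤ Re z ≤ β'} ∪ (iγ₁ - Hyp_γ̃) ∪ (iγ₂ + Hyp_γ̃)`. -/
def closedRegion (a b α β γ₁ γ₂ : ℝ) : Set ℂ :=
  {z | alphaPrime a b α γ₁ γ₂ ≤ z.re ∧ z.re ≤ betaPrime a b β γ₁ γ₂} ∪ hypRegion a b γ₁ γ₂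

/-- `r = √(a² + b² |w|²)`, the radius of the disk around the eigenvalue `w`. -/
def rad (a b : ℝ) (w : ℂ) : ℝ := √(a ^ 2 + b ^ 2 * ‖w‖ ^ 2)

end NormalPerturbation

end

noncomputable section

namespace NormalPerturbation

open Complex Metric Set MeasureTheory
open scoped Real

/-! ### Banach-valued circle integrals. -/

section CircleIntegral

variable {E F : Type*} [NormedAddCommGroup E] [NormedSpace ℂ E]
  [NormedAddCommGroup F] [NormedSpace ℂ F]

/-! The inequality `a² + b²|w|² < |w - z|²` for all `w ∈ σ(T)` decides everything. Under it `(T -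
z)⁻¹` is a bounded normal operator, and the functional calculus bounds `‖A(T - z)⁻¹u‖²` by `M‖u‖²`,
where `M` is the maximum over `σ((T - z)⁻¹)` of a function with values below 1. A Neumann series
then puts `z` in the resolvent set of `T + tA` for all `|t| ≤ 1` (`IsNormal.isUnit_pencil_add`).
Plane geometry (`add_norm_sq_lt_of_mem_openRegion`) gives the inequality on `U` for `w` in the
gapped strip; off the disk around `λ_j` it holds for `w = λ_j` by the choice of `r_j`. This is (i).

For (ii), a slightly larger circle around `λ_k` lies in the resolvent set of `T + tA` for every `t ∈
[0, 1]`. Its Riesz projection is a norm-continuous family of idempotents, so its rank is constant.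
At `t = 0` the range is `ker (T - λ_k)` by normality (`IsNormal.range_rieszProj`); at `t = 1` the
rank is the total algebraic multiplicity in the disk (`IsPencil.hasTotalAlgMult`). Part (iii) adds
up disjoint disks.

Unbounded operators are handled as `S = C R⁻¹` with `R`, `C` bounded: `S - z` becomes the linear
pencil `C - zR`, and adding `A` only changes `C`, so all contour integrals live in one Banach
algebra. -/

theorem map_circleIntegral [CompleteSpace E] [CompleteSpace F] (L : E →L[ℂ] F) {f : ℂ → E}
    {c : ℂ} {r : ℝ} (hf : CircleIntegrable f c r) :
    L (∮ z in C(c, r), f z) = ∮ z in C(c, r), L (f z) := by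
  unfold circleIntegral
  rw [← L.intervalIntegral_comp_comm hf.out]
  simp

/-- The iterated integral of a continuous function over two circles does not depend on the order
of integration. -/
theorem circleIntegral_swap {f : ℂ → ℂ → E} {c : ℂ} {r s : ℝ} (hr : 0 ≤ r) (hs : 0 ≤ s)
    (hf : ContinuousOn (Function.uncurry f) (sphere c r ×ˢ sphere c s)) :
    (∮ z in C(c, r), ∮ w in C(c, s), f z w) = ∮ w in C(c, s), ∮ z in C(c, r), f z w := by
  have hcont : Continuous fun p : ℝ × ℝ =>
      deriv (circleMap c r) p.1 • deriv (circleMap c s) p.2 •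
        f (circleMap c r p.1) (circleMap c s p.2) := by
    have h1 : Continuous fun p : ℝ × ℝ =>
        Function.uncurry f (circleMap c r p.1, circleMap c s p.2) := by
      refine hf.comp_continuous ?_ fun p => ⟨?_, ?_⟩
      · fun_prop
      · exact circleMap_mem_sphere c hr _
      · exact circleMap_mem_sphere c hs _
    simp only [deriv_circleMap]
    exact Continuous.smul (by fun_prop) (Continuous.smul (by fun_prop) h1)
  have hpi : (0 : ℝ) ≤ 2 * π := by positivity
  have hint : Integrable (Function.uncurry fun x y : ℝ =>
      deriv (circleMap c r) x • deriv (circleMap c s) y •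
        f (circleMap c r x) (circleMap c s y))
      ((volume.restrict (Ioc 0 (2 * π))).prod (volume.restrict (Ioc 0 (2 * π)))) := by
    rw [Measure.prod_restrict]
    have : IntegrableOn (fun p : ℝ × ℝ => deriv (circleMap c r) p.1 • deriv (circleMap c s) p.2 •
        f (circleMap c r p.1) (circleMap c s p.2)) (Icc 0 (2 * π) ×ˢ Icc 0 (2 * π))
        ((volume : Measure ℝ).prod volume) :=
      hcont.continuousOn.integrableOn_compact (isCompact_Icc.prod isCompact_Icc)
    exact this.mono_set (prod_mono Ioc_subset_Icc_self Ioc_subset_Icc_self)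
  have hswap := integral_integral_swap hint
  simp only [circleIntegral, intervalIntegral.integral_of_le hpi]
  simp_rw [← integral_smul]
  rw [hswap]
  simp_rw [smul_comm (deriv (circleMap c r) _)]

theorem circleIntegral_sub_inv_of_not_mem {c w : ℂ} {r : ℝ} (hr : 0 ≤ r)
    (hw : w ∉ closedBall c r) : (∮ z in C(c, r), (z - w)⁻¹) = 0 := by
  have hne : ∀ z ∈ closedBall c r, z - w ≠ 0 := fun z hz h =>
    hw (by rwa [← sub_eq_zero.mp h])
  refine circleIntegral_eq_zero_of_differentiable_on_off_countable hr countable_empty ?_ ?_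
  · exact ContinuousOn.inv₀ (by fun_prop) hne
  · intro z hz
    exact DifferentiableAt.inv (by fun_prop) (hne z (ball_subset_closedBall hz.1))

theorem circleIntegral_const_eq_zero [CompleteSpace E] (x : E) (c : ℂ) (r : ℝ) :
    (∮ _ in C(c, r), x) = 0 := by
  have := circleIntegral.integral_sub_zpow_of_ne (n := 0) (by norm_num) c 0 r
  have h2 := circleIntegral.integral_smul_const (fun _ => (1 : ℂ)) x c r
  simp only [one_smul] at h2
  rw [h2]
  simpa using congrArg (· • x) this

end CircleIntegral

/-! ### Resolvents and Riesz projections of linear pencils in a Banach algebra. -/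

section Pencil

variable {𝔸 : Type*} [NormedRing 𝔸] [NormedAlgebra ℂ 𝔸]

/-- The resolvent `R (C - z R)⁻¹` of the linear pencil `C - z R`. -/
def pencilRes (R C : 𝔸) (z : ℂ) : 𝔸 := R * Ring.inverse (C - z • R)

/-- The Riesz projection of the pencil `C - z R` for the circle of radius `r` around `c`. -/
def rieszProj (R C : 𝔸) (c : ℂ) (r : ℝ) : 𝔸 :=
  -((2 * π * I : ℂ)⁻¹ • ∮ z in C(c, r), pencilRes R C z)

variable {R C : 𝔸} {c : ℂ} {r : ℝ}

theorem pencil_mul_inverse {w : ℂ} (z : ℂ) (hw : IsUnit (C - w • R)) :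
    (C - z • R) * Ring.inverse (C - w • R) = 1 + (w - z) • pencilRes R C w := by
  have h : C - z • R = (C - w • R) + (w - z) • R := by module
  rw [h, add_mul, Ring.mul_inverse_cancel _ hw, pencilRes, smul_mul_assoc]

theorem pencilRes_mul_pencil {w : ℂ} (z : ℂ) (hw : IsUnit (C - w • R)) :
    pencilRes R C w * (C - z • R) = R + (w - z) • (pencilRes R C w * R) := by
  have h : C - z • R = (C - w • R) + (w - z) • R := by module
  rw [h, mul_add, pencilRes, mul_assoc, Ring.inverse_mul_cancel _ hw, mul_one, mul_smul_comm]

/-- The first resolvent identity. It needs no commutation between `R` and `C`. -/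
theorem pencilRes_sub_pencilRes {z w : ℂ} (hz : IsUnit (C - z • R)) (hw : IsUnit (C - w • R)) :
    pencilRes R C z - pencilRes R C w = (z - w) • (pencilRes R C z * pencilRes R C w) := by
  have h1 := congrArg (· * Ring.inverse (C - w • R)) (pencilRes_mul_pencil w hz)
  simp only [mul_assoc, Ring.mul_inverse_cancel _ hw, mul_one, add_mul, smul_mul_assoc] at h1
  exact sub_eq_iff_eq_add'.mpr h1

variable [CompleteSpace 𝔸]

theorem differentiableAt_inverse_pencil {z : ℂ} (hz : IsUnit (C - z • R)) :
    DifferentiableAt ℂ (fun z : ℂ => Ring.inverse (C - z • R)) z := by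
  have h1 : DifferentiableAt ℂ (fun z : ℂ => C - z • R) z := by fun_prop
  exact (differentiableAt_inverse (𝕜 := ℂ) hz).comp z h1

theorem differentiableAt_pencilRes {z : ℂ} (hz : IsUnit (C - z • R)) :
    DifferentiableAt ℂ (pencilRes R C) z :=
  (differentiableAt_inverse_pencil hz).const_mul R

theorem continuousOn_pencilRes {s : Set ℂ} (h : ∀ z ∈ s, IsUnit (C - z • R)) :
    ContinuousOn (pencilRes R C) s := fun z hz =>
  (differentiableAt_pencilRes (h z hz)).continuousAt.continuousWithinAt

theorem continuousOn_inverse_pencil {s : Set ℂ} (h : ∀ z ∈ s, IsUnit (C - z • R)) :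
    ContinuousOn (fun z : ℂ => Ring.inverse (C - z • R)) s := fun z hz =>
  (differentiableAt_inverse_pencil (h z hz)).continuousAt.continuousWithinAt

theorem rieszProj_eq_of_annulus {s : ℝ} (hs : 0 < s) (hsr : s ≤ r)
    (h : ∀ z ∈ closedBall c r, z ∉ ball c s → IsUnit (C - z • R)) :
    rieszProj R C c r = rieszProj R C c s := by
  unfold rieszProj
  rw [circleIntegral_eq_of_differentiable_on_annulus_off_countable hs hsr countable_empty]
  · exact continuousOn_pencilRes fun z hz => h z hz.1 hz.2
  · rintro z ⟨⟨hz1, hz2⟩, -⟩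
    exact differentiableAt_pencilRes (h z (ball_subset_closedBall hz1)
      fun h' => hz2 (ball_subset_closedBall h'))

/-- Write the two factors as integrals over concentric circles of radii `r` and `s`. The resolvent
identity splits the product into two terms: `∮ (z - w)⁻¹ dw` over the inner circle vanishes because
`z` lies outside it, and after exchanging the integrals `∮ (z - w)⁻¹ dz` over the outer circle
equals `2πi`. -/
theorem rieszProj_mul_self {s : ℝ} (hs : 0 < s) (hsr : s < r)
    (h : ∀ z ∈ closedBall c r, z ∉ ball c s → IsUnit (C - z • R)) :
    rieszProj R C c r * rieszProj R C c r = rieszProj R C c r := by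
  have hr : 0 < r := hs.trans hsr
  have hur : ∀ z ∈ sphere c r, IsUnit (C - z • R) := fun z hz =>
    h z (sphere_subset_closedBall hz) (by rw [mem_sphere] at hz; simp [hz, hsr.le])
  have hus : ∀ z ∈ sphere c s, IsUnit (C - z • R) := fun z hz => by
    rw [mem_sphere] at hz
    exact h z (by simp [hz, hsr.le]) (by simp [hz])
  have hcr := continuousOn_pencilRes hur
  have hcs := continuousOn_pencilRes hus
  have hne : ∀ z ∈ sphere c r, ∀ w ∈ sphere c s, z - w ≠ 0 := by
    intro z hz w hw h0
    rw [sub_eq_zero.mp h0] at hz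
    rw [mem_sphere] at hz hw
    linarith
  have key : (∮ z in C(c, r), pencilRes R C z) * (∮ w in C(c, s), pencilRes R C w) =
      -((2 * π * I : ℂ) • ∮ w in C(c, s), pencilRes R C w) := by
    have e1 : (∮ z in C(c, r), pencilRes R C z) * (∮ w in C(c, s), pencilRes R C w) =
        ∮ z in C(c, r), ∮ w in C(c, s), pencilRes R C z * pencilRes R C w := by
      rw [show (∮ z in C(c, r), pencilRes R C z) * (∮ w in C(c, s), pencilRes R C w) =
        (ContinuousLinearMap.mul ℂ 𝔸).flip (∮ w in C(c, s), pencilRes R C w)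
          (∮ z in C(c, r), pencilRes R C z) from rfl,
        map_circleIntegral _ (hcr.circleIntegrable hr.le)]
      refine circleIntegral.integral_congr hr.le fun z hz => ?_
      exact map_circleIntegral (ContinuousLinearMap.mul ℂ 𝔸 (pencilRes R C z))
        (hcs.circleIntegrable hs.le)
    have e2 : (∮ z in C(c, r), ∮ w in C(c, s), pencilRes R C z * pencilRes R C w) =
        ∮ z in C(c, r), -∮ w in C(c, s), (z - w)⁻¹ • pencilRes R C w := by
      refine circleIntegral.integral_congr hr.le fun z hz => ?_
      have hzs : z ∉ closedBall c s := by
        rw [mem_sphere] at hz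
        simp [hz, hsr]
      have hi : ContinuousOn (fun w : ℂ => (z - w)⁻¹) (sphere c s) :=
        ContinuousOn.inv₀ (by fun_prop) fun w hw => hne z hz w hw
      have e3 : (∮ w in C(c, s), pencilRes R C z * pencilRes R C w) =
          ∮ w in C(c, s), ((z - w)⁻¹ • pencilRes R C z - (z - w)⁻¹ • pencilRes R C w) := by
        refine circleIntegral.integral_congr hs.le fun w hw => ?_
        rw [← smul_sub, pencilRes_sub_pencilRes (hur z hz) (hus w hw),
          inv_smul_smul₀ (hne z hz w hw)]
      rw [e3, circleIntegral.integral_sub, circleIntegral.integral_smul_const]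
      · have : (∮ w in C(c, s), (z - w)⁻¹) = 0 := by
          have h4 := circleIntegral_sub_inv_of_not_mem hs.le hzs
          have h5 := circleIntegral.integral_smul (-1 : ℂ) (fun w => (w - z)⁻¹) c s
          rw [h4, smul_zero] at h5
          rw [← h5]
          congr 1
          ext w
          rw [smul_eq_mul, ← neg_sub w z, inv_neg]
          ring
        rw [this, zero_smul, zero_sub]
      · exact (hi.smul continuousOn_const).circleIntegrable hs.le
      · exact (hi.smul hcs).circleIntegrable hs.le
    have e4 : (∮ z in C(c, r), -∮ w in C(c, s), (z - w)⁻¹ • pencilRes R C w) =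
        -∮ z in C(c, r), ∮ w in C(c, s), (z - w)⁻¹ • pencilRes R C w := by
      have := circleIntegral.integral_smul (-1 : ℂ)
        (fun z => ∮ w in C(c, s), (z - w)⁻¹ • pencilRes R C w) c r
      simpa using this
    rw [e1, e2, e4, circleIntegral_swap hr.le hs.le]
    · congr 1
      rw [← circleIntegral.integral_smul]
      refine circleIntegral.integral_congr hs.le fun w hw => ?_
      rw [circleIntegral.integral_smul_const, circleIntegral.integral_sub_inv_of_mem_ball]
      rw [mem_sphere] at hw
      simpa [hw] using hsr
    · refine ContinuousOn.smul (ContinuousOn.inv₀ (by fun_prop) ?_) ?_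
      · exact fun p hp => hne _ hp.1 _ hp.2
      · exact hcs.comp continuousOn_snd fun p hp => hp.2
  have e := rieszProj_eq_of_annulus hs hsr.le h
  have hP : rieszProj R C c r * rieszProj R C c s = rieszProj R C c s := by
    unfold rieszProj
    rw [neg_mul_neg, smul_mul_smul_comm, key, smul_neg, smul_smul, mul_assoc,
      inv_mul_cancel₀ (by simp [Real.pi_ne_zero]), mul_one]
  calc rieszProj R C c r * rieszProj R C c r
      = rieszProj R C c r * rieszProj R C c s := congrArg (rieszProj R C c r * ·) e
    _ = rieszProj R C c s := hP
    _ = rieszProj R C c r := e.symm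

/-- The Riesz projection takes values in the range of `R`. -/
theorem rieszProj_eq_mul (hr : 0 ≤ r) (h : ∀ z ∈ sphere c r, IsUnit (C - z • R)) :
    rieszProj R C c r =
      R * -((2 * π * I : ℂ)⁻¹ • ∮ z in C(c, r), Ring.inverse (C - z • R)) := by
  have h1 := map_circleIntegral (ContinuousLinearMap.mul ℂ 𝔸 R)
    ((continuousOn_inverse_pencil h).circleIntegrable hr)
  simp only [ContinuousLinearMap.mul_apply'] at h1
  rw [mul_neg, mul_smul_comm, h1]
  rfl

theorem rieszProj_mul (hr : 0 ≤ r) (h : ∀ z ∈ sphere c r, IsUnit (C - z • R)) (D : 𝔸) :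
    rieszProj R C c r * D = -((2 * π * I : ℂ)⁻¹ • ∮ z in C(c, r), pencilRes R C z * D) := by
  have h1 := map_circleIntegral ((ContinuousLinearMap.mul ℂ 𝔸).flip D)
    ((continuousOn_pencilRes h).circleIntegrable hr)
  simp only [ContinuousLinearMap.flip_apply, ContinuousLinearMap.mul_apply'] at h1
  rw [rieszProj, neg_mul, smul_mul_assoc, h1]

/-- The Riesz projection factors through `R`, compatibly with multiplication by `C`. -/
theorem exists_rieszProj_factor (hr : 0 ≤ r) (h : ∀ z ∈ sphere c r, IsUnit (C - z • R)) :
    ∃ X : 𝔸, rieszProj R C c r = R * X ∧ C * X * R = rieszProj R C c r * C ∧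
      ∀ z, (C - z • R) * X = -((2 * π * I : ℂ)⁻¹ • ∮ w in C(c, r), (w - z) • pencilRes R C w) := by
  have hX (D : 𝔸) := map_circleIntegral (ContinuousLinearMap.mul ℂ 𝔸 D)
    ((continuousOn_inverse_pencil h).circleIntegrable hr)
  simp only [ContinuousLinearMap.mul_apply'] at hX
  have hmul (z : ℂ) : (C - z • R) * -((2 * π * I : ℂ)⁻¹ •
      ∮ w in C(c, r), Ring.inverse (C - w • R)) =
      -((2 * π * I : ℂ)⁻¹ • ∮ w in C(c, r), (w - z) • pencilRes R C w) := by
    rw [mul_neg, mul_smul_comm, hX]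
    congr 2
    have h2 : (∮ w in C(c, r), (C - z • R) * Ring.inverse (C - w • R)) =
        ∮ w in C(c, r), ((1 : 𝔸) + (w - z) • pencilRes R C w) :=
      circleIntegral.integral_congr hr fun w hw => pencil_mul_inverse z (h w hw)
    -- The constant term of `(C - zR)(C - wR)⁻¹ = 1 + (w - z)R(C - wR)⁻¹` integrates to zero.
    rw [h2, circleIntegral.integral_add, circleIntegral_const_eq_zero, zero_add]
    · exact circleIntegrable_const _ _ _
    · refine ContinuousOn.circleIntegrable hr
        (ContinuousOn.smul (by fun_prop) (continuousOn_pencilRes h))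
  refine ⟨_, rieszProj_eq_mul hr h, ?_, hmul⟩
  have h0 := hmul 0
  simp only [zero_smul, sub_zero] at h0
  have hid : ContinuousOn (fun w : ℂ => w • pencilRes R C w) (sphere c r) :=
    continuousOn_id.smul (continuousOn_pencilRes h)
  have h1 := map_circleIntegral ((ContinuousLinearMap.mul ℂ 𝔸).flip R) (hid.circleIntegrable hr)
  simp only [ContinuousLinearMap.flip_apply, ContinuousLinearMap.mul_apply'] at h1
  rw [h0, rieszProj_mul hr h, neg_mul, smul_mul_assoc, h1]
  congr 2
  have h2 : (∮ w in C(c, r), pencilRes R C w * C) =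
      ∮ w in C(c, r), (R + w • pencilRes R C w * R) := by
    refine circleIntegral.integral_congr hr fun w hw => ?_
    have := pencilRes_mul_pencil 0 (h w hw)
    simpa [smul_mul_assoc] using this
  rw [h2, circleIntegral.integral_add, circleIntegral_const_eq_zero, zero_add]
  · exact circleIntegrable_const _ _ _
  · exact (hid.mul continuousOn_const).circleIntegrable hr

/-- For `z` inside the circle, the pencil is invertible modulo the Riesz projection. -/
theorem exists_inverse_mod_rieszProj (hr : 0 ≤ r) (h : ∀ z ∈ sphere c r, IsUnit (C - z • R))
    {z : ℂ} (hz : z ∈ ball c r) :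
    ∃ Y : 𝔸, (C - z • R) * Y = 1 - rieszProj R C c r ∧
      R * Y * (C - z • R) = (1 - rieszProj R C c r) * R := by
  have hne : ∀ w ∈ sphere c r, w - z ≠ 0 := by
    intro w hw h0
    rw [mem_sphere, sub_eq_zero.mp h0] at hw
    rw [mem_ball] at hz
    linarith
  have hinv : ContinuousOn (fun w : ℂ => (w - z)⁻¹) (sphere c r) :=
    ContinuousOn.inv₀ (by fun_prop) hne
  have hY : ContinuousOn (fun w : ℂ => (w - z)⁻¹ • Ring.inverse (C - w • R)) (sphere c r) :=
    hinv.smul (continuousOn_inverse_pencil h)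
  have hYi := hY.circleIntegrable hr
  have hres := continuousOn_pencilRes h
  have hone : (∮ w in C(c, r), (w - z)⁻¹) = 2 * π * I :=
    circleIntegral.integral_sub_inv_of_mem_ball hz
  -- After multiplication by `C - zR`, the factor `(w - z)⁻¹` isolates a term `(w - z)⁻¹ • 1`, which
  -- integrates to the identity; what remains is minus the Riesz projection.
  refine ⟨(2 * π * I : ℂ)⁻¹ • ∮ w in C(c, r), (w - z)⁻¹ • Ring.inverse (C - w • R), ?_, ?_⟩
  · have h1 := map_circleIntegral (ContinuousLinearMap.mul ℂ 𝔸 (C - z • R)) hYi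
    simp only [ContinuousLinearMap.mul_apply'] at h1
    have h2 : (∮ w in C(c, r), (C - z • R) * ((w - z)⁻¹ • Ring.inverse (C - w • R))) =
        ∮ w in C(c, r), ((w - z)⁻¹ • (1 : 𝔸) + pencilRes R C w) := by
      refine circleIntegral.integral_congr hr fun w hw => ?_
      simp only [mul_smul_comm]
      rw [pencil_mul_inverse z (h w hw), smul_add, inv_smul_smul₀ (hne w hw)]
    rw [mul_smul_comm, h1, h2, circleIntegral.integral_add, circleIntegral.integral_smul_const,
      hone, smul_add, inv_smul_smul₀ two_pi_I_ne_zero, rieszProj, sub_neg_eq_add]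
    · exact (hinv.smul continuousOn_const).circleIntegrable hr
    · exact hres.circleIntegrable hr
  · have h1 := map_circleIntegral (ContinuousLinearMap.mul ℂ 𝔸 R) hYi
    simp only [ContinuousLinearMap.mul_apply', mul_smul_comm] at h1
    have hc : ContinuousOn (fun w : ℂ => (w - z)⁻¹ • (R * Ring.inverse (C - w • R)))
        (sphere c r) := hinv.smul hres
    have h3 := map_circleIntegral ((ContinuousLinearMap.mul ℂ 𝔸).flip (C - z • R))
      (hc.circleIntegrable hr)
    simp only [ContinuousLinearMap.flip_apply, ContinuousLinearMap.mul_apply'] at h3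
    have h2 : (∮ w in C(c, r), (w - z)⁻¹ • (R * Ring.inverse (C - w • R)) * (C - z • R)) =
        ∮ w in C(c, r), ((w - z)⁻¹ • R + pencilRes R C w * R) := by
      refine circleIntegral.integral_congr hr fun w hw => ?_
      simp only [smul_mul_assoc]
      rw [← pencilRes, pencilRes_mul_pencil z (h w hw), smul_add, inv_smul_smul₀ (hne w hw)]
    rw [mul_smul_comm, h1, smul_mul_assoc, h3, h2, circleIntegral.integral_add,
      circleIntegral.integral_smul_const, hone, smul_add, inv_smul_smul₀ two_pi_I_ne_zero,
      sub_mul, one_mul, rieszProj_mul hr h, sub_neg_eq_add]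
    · exact (hinv.smul continuousOn_const).circleIntegrable hr
    · exact (hres.mul continuousOn_const).circleIntegrable hr

/-- The Riesz projection depends continuously on the pencil. -/
theorem continuous_rieszProj {X : Type*} [TopologicalSpace X] {C : X → 𝔸} (hC : Continuous C)
    (hr : 0 ≤ r) (h : ∀ x, ∀ z ∈ sphere c r, IsUnit (C x - z • R)) :
    Continuous fun x => rieszProj R (C x) c r := by
  have hcont : Continuous fun p : X × ℝ =>
      deriv (circleMap c r) p.2 • pencilRes R (C p.1) (circleMap c r p.2) := by
    have h1 : Continuous fun p : X × ℝ => Ring.inverse (C p.1 - circleMap c r p.2 • R) := by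
      refine continuous_iff_continuousAt.mpr fun p => ?_
      obtain ⟨u, hu⟩ := h p.1 (circleMap c r p.2) (circleMap_mem_sphere c hr _)
      have h2 : ContinuousAt (fun p : X × ℝ => C p.1 - circleMap c r p.2 • R) p := by
        fun_prop
      exact ContinuousAt.comp (g := Ring.inverse) (hu ▸ NormedRing.inverse_continuousAt u) h2
    simp only [deriv_circleMap, pencilRes]
    exact Continuous.smul (by fun_prop) (continuous_const.mul h1)
  unfold rieszProj circleIntegral
  exact ((intervalIntegral.continuous_parametric_intervalIntegral_of_continuous'
    hcont 0 (2 * π)).const_smul _).neg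

end Pencil

/-! ### Unbounded operators as pencils. -/

section Factor

variable {H : Type*} [NormedAddCommGroup H] [InnerProductSpace ℂ H]

/-- The operator `S` equals `C R⁻¹`, where `R` and `C` are bounded and `R` is injective. -/
def IsPencil (S : H →ₗ.[ℂ] H) (R C : H →L[ℂ] H) : Prop :=
  Function.Injective R ∧ (∀ x, x ∈ S.domain ↔ ∃ u, R u = x) ∧
    ∀ u (h : R u ∈ S.domain), S ⟨R u, h⟩ = C u

variable {S : H →ₗ.[ℂ] H} {R C : H →L[ℂ] H}

theorem shift_apply (S : H →ₗ.[ℂ] H) (z : ℂ) (x : S.domain) :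
    shift S z x = S x - z • (x : H) := rfl

theorem IsPencil.mem_domain (hp : IsPencil S R C) (u : H) : R u ∈ S.domain :=
  (hp.2.1 _).mpr ⟨u, rfl⟩

theorem IsPencil.shift_apply (hp : IsPencil S R C) (z : ℂ) (u : H) (h : R u ∈ S.domain) :
    shift S z ⟨R u, h⟩ = (C - z • R) u := by
  simp [NormalPerturbation.shift_apply, hp.2.2 u h]

theorem mem_eigenspace_iff {z : ℂ} {x : H} :
    x ∈ eigenspace S z ↔ ∃ h : x ∈ S.domain, S ⟨x, h⟩ = z • x := by
  simp only [eigenspace, Submodule.mem_map, LinearMap.mem_ker, shift_apply, sub_eq_zero]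
  constructor
  · rintro ⟨y, hy, rfl⟩
    exact ⟨y.2, hy⟩
  · rintro ⟨h, hx⟩
    exact ⟨⟨x, h⟩, hx, rfl⟩

theorem mem_kerPow_succ_iff {z : ℂ} {n : ℕ} {x : H} :
    x ∈ kerPow S z (n + 1) ↔ ∃ h : x ∈ S.domain, S ⟨x, h⟩ - z • x ∈ kerPow S z n := by
  simp only [kerPow, Submodule.mem_map, Submodule.mem_comap, shift_apply]
  constructor
  · rintro ⟨y, hy, rfl⟩
    exact ⟨y.2, hy⟩
  · rintro ⟨h, hx⟩
    exact ⟨⟨x, h⟩, hx, rfl⟩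

/-- The map `u ↦ R u` is a bijection of `H` onto `D(S)` that turns `S - z` into `C - zR`; a bounded
bijection of `H` is invertible. -/
theorem IsPencil.mem_resolventSet_iff [CompleteSpace H] (hp : IsPencil S R C) {z : ℂ} :
    z ∈ resolventSet S ↔ IsUnit (C - z • R) := by
  rw [ContinuousLinearMap.isUnit_iff_bijective]
  let J : H → S.domain := fun u => ⟨R u, hp.mem_domain u⟩
  have hJ : Function.Bijective J := by
    refine ⟨fun u v huv => hp.1 (congrArg Subtype.val huv), fun x => ?_⟩
    obtain ⟨u, hu⟩ := (hp.2.1 x).mp x.2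
    exact ⟨u, Subtype.ext hu⟩
  have hcomp : shift S z ∘ J = (C - z • R : H →L[ℂ] H) :=
    funext fun u => hp.shift_apply z u _
  rw [← hcomp]
  exact (Function.Bijective.of_comp_iff _ hJ).symm

variable [CompleteSpace H] {c : ℂ} {r : ℝ}

/-- On an eigenvector the pencil resolvent acts as a scalar. -/
theorem IsPencil.pencilRes_apply_of_eigen (hp : IsPencil S R C) {μ w : ℂ} {x : H}
    (hx : x ∈ eigenspace S μ) (hw : IsUnit (C - w • R)) (hμ : w ≠ μ) :
    pencilRes R C w x = -((w - μ)⁻¹ • x) := by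
  obtain ⟨h, hx⟩ := mem_eigenspace_iff.mp hx
  obtain ⟨u, rfl⟩ := (hp.2.1 x).mp h
  rw [hp.2.2] at hx
  have h1 : (C - w • R) u = (μ - w) • R u := by
    simp [hx, sub_smul]
  have h2 : Ring.inverse (C - w • R) ((C - w • R) u) = u := by
    rw [← mul_apply_eq_comp, Ring.inverse_mul_cancel _ hw]
    rfl
  rw [h1, map_smul] at h2
  have hne : w - μ ≠ 0 := sub_ne_zero.mpr hμ
  have h3 : pencilRes R C w (R u) = R (Ring.inverse (C - w • R) (R u)) := rfl
  have h4 : (w - μ) • pencilRes R C w (R u) = - R u := by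
    rw [h3, ← map_smul, ← neg_sub μ w, neg_smul, h2, map_neg]
  rw [← smul_neg, ← h4, inv_smul_smul₀ hne]

theorem rieszProj_apply (hr : 0 ≤ r) (h : ∀ z ∈ sphere c r, IsUnit (C - z • R)) (x : H) :
    rieszProj R C c r x = -((2 * π * I : ℂ)⁻¹ • ∮ z in C(c, r), pencilRes R C z x) := by
  have h1 := map_circleIntegral (ContinuousLinearMap.apply ℂ H x)
    ((continuousOn_pencilRes h).circleIntegrable hr)
  simp only [ContinuousLinearMap.apply_apply] at h1
  rw [rieszProj, neg_apply, smul_apply, h1]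

theorem IsPencil.rieszProj_apply_of_eigen (hp : IsPencil S R C) (hr : 0 ≤ r)
    (h : ∀ z ∈ sphere c r, IsUnit (C - z • R)) {μ : ℂ} {x : H} (hx : x ∈ eigenspace S μ)
    (hμ : μ ∉ sphere c r) :
    rieszProj R C c r x = ((2 * π * I : ℂ)⁻¹ * ∮ z in C(c, r), (z - μ)⁻¹) • x := by
  have h1 : (∮ z in C(c, r), pencilRes R C z x) = ∮ z in C(c, r), (-(1 : ℂ)) • ((z - μ)⁻¹ • x) := by
    refine circleIntegral.integral_congr hr fun w hw => ?_
    have hwμ : w ≠ μ := fun e => hμ (e ▸ hw)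
    simp [hp.pencilRes_apply_of_eigen hx (h w hw) hwμ]
  rw [rieszProj_apply hr h, h1, circleIntegral.integral_smul,
    circleIntegral.integral_smul_const, neg_one_smul, smul_neg, neg_neg, mul_smul]

theorem IsPencil.rieszProj_apply_of_eigen_of_mem_ball (hp : IsPencil S R C) (hr : 0 ≤ r)
    (h : ∀ z ∈ sphere c r, IsUnit (C - z • R)) {μ : ℂ} {x : H} (hx : x ∈ eigenspace S μ)
    (hμ : μ ∈ ball c r) : rieszProj R C c r x = x := by
  rw [hp.rieszProj_apply_of_eigen hr h hx, circleIntegral.integral_sub_inv_of_mem_ball hμ,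
    inv_mul_cancel₀ two_pi_I_ne_zero, one_smul]
  intro h'
  rw [mem_sphere] at h'
  rw [mem_ball] at hμ
  linarith

theorem IsPencil.rieszProj_apply_of_eigen_of_not_mem_closedBall (hp : IsPencil S R C) (hr : 0 ≤ r)
    (h : ∀ z ∈ sphere c r, IsUnit (C - z • R)) {μ : ℂ} {x : H} (hx : x ∈ eigenspace S μ)
    (hμ : μ ∉ closedBall c r) : rieszProj R C c r x = 0 := by
  rw [hp.rieszProj_apply_of_eigen hr h hx fun h' => hμ (sphere_subset_closedBall h'),
    circleIntegral_sub_inv_of_not_mem hr hμ, mul_zero, zero_smul]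

end Factor

/-! ### Algebraic multiplicities and reducing idempotents. -/

section Decomposition

variable {H : Type*} [NormedAddCommGroup H] [InnerProductSpace ℂ H]

/-- An idempotent `P` onto a subspace of `D(S)` that commutes with `S`. -/
structure IsReducing (S : H →ₗ.[ℂ] H) (P : H →ₗ[ℂ] H) : Prop where
  mem_domain : ∀ x, P x ∈ S.domain
  idem : ∀ x, P (P x) = P x
  comm : ∀ x : S.domain, S ⟨P x, mem_domain x⟩ = P (S x)

namespace IsReducing

variable {S : H →ₗ.[ℂ] H} {P : H →ₗ[ℂ] H}

theorem apply_eq (hP : IsReducing S P) {x : H} (hx : x ∈ LinearMap.range P) : P x = x := by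
  obtain ⟨y, rfl⟩ := hx
  exact hP.idem y

theorem range_le (hP : IsReducing S P) : LinearMap.range P ≤ S.domain := by
  rintro _ ⟨x, rfl⟩
  exact hP.mem_domain x

theorem map_mem_range (hP : IsReducing S P) (x : LinearMap.range P) :
    S ⟨x, hP.range_le x.2⟩ ∈ LinearMap.range P := by
  refine ⟨S ⟨x, hP.range_le x.2⟩, ?_⟩
  rw [← hP.comm]
  congr 1
  exact Subtype.ext (hP.apply_eq x.2)

/-- The part of `S` in the range of `P`. -/
def part (hP : IsReducing S P) : Module.End ℂ (LinearMap.range P) :=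
  (S.toFun ∘ₗ Submodule.inclusion hP.range_le).codRestrict _ hP.map_mem_range

theorem coe_part_apply (hP : IsReducing S P) (x : LinearMap.range P) :
    (hP.part x : H) = S ⟨x, hP.range_le x.2⟩ := rfl

variable {z : ℂ}

/-- `S - z` is injective modulo the range of `P`. -/
def InjMod (S : H →ₗ.[ℂ] H) (P : H →ₗ[ℂ] H) (z : ℂ) : Prop :=
  ∀ x : S.domain, shift S z x = 0 → P x = x

/-- `S - z` is surjective modulo the range of `P`. -/
def SurjMod (S : H →ₗ.[ℂ] H) (P : H →ₗ[ℂ] H) (z : ℂ) : Prop :=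
  ∀ y : H, ∃ x : S.domain, shift S z x = y - P y

/-- If `(S - z)x` lies in the range of `P`, then `P` fixes it, so `(S - z)(x - Px) = 0`. Hence `P`
fixes `x - Px`; it also annihilates it, so `x = Px`. -/
theorem kerPow_le_range (hP : IsReducing S P) (h : InjMod S P z) (n : ℕ) :
    kerPow S z n ≤ LinearMap.range P := by
  induction n with
  | zero => exact bot_le
  | succ n ih =>
    intro x hx
    obtain ⟨hxS, hx⟩ := mem_kerPow_succ_iff.mp hx
    have h1 : P (S ⟨x, hxS⟩ - z • x) = S ⟨x, hxS⟩ - z • x := hP.apply_eq (ih hx)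
    have h2 : shift S z (⟨x, hxS⟩ - ⟨P x, hP.mem_domain x⟩) = 0 := by
      rw [map_sub, shift_apply, shift_apply, hP.comm ⟨x, hxS⟩, ← h1, map_sub, map_smul, sub_self]
    have h3 := h _ h2
    simp only [AddSubgroupClass.coe_sub, map_sub, hP.idem, sub_self] at h3
    exact ⟨x, (sub_eq_zero.mp h3.symm).symm⟩

theorem kerPow_eq_map (hP : IsReducing S P) (h : InjMod S P z) (n : ℕ) :
    kerPow S z n = (LinearMap.ker ((hP.part - z • 1) ^ n)).map
      (LinearMap.range P).subtype := by
  induction n with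
  | zero =>
    have : LinearMap.ker (1 : Module.End ℂ (LinearMap.range P)) = ⊥ := LinearMap.ker_id
    simp [kerPow, this]
  | succ n ih =>
    ext x
    rw [mem_kerPow_succ_iff, ih]
    simp only [Submodule.mem_map, LinearMap.mem_ker, pow_succ, Module.End.mul_apply]
    constructor
    · rintro ⟨hxS, y, hy, hyx⟩
      have hx : x ∈ LinearMap.range P := by
        refine hP.kerPow_le_range h (n + 1) (mem_kerPow_succ_iff.mpr ⟨hxS, ?_⟩)
        rw [ih]
        exact ⟨y, hy, hyx⟩
      refine ⟨⟨x, hx⟩, ?_, rfl⟩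
      have : (hP.part - z • 1) ⟨x, hx⟩ = y := by
        refine Subtype.ext ?_
        rw [← Submodule.subtype_apply, ← Submodule.subtype_apply, hyx]
        simp [coe_part_apply]
      rw [this, hy]
    · rintro ⟨y, hy, rfl⟩
      refine ⟨hP.range_le y.2, _, hy, ?_⟩
      simp [coe_part_apply]

theorem rootSpace_eq_map (hP : IsReducing S P) (h : InjMod S P z) :
    rootSpace S z = (hP.part.maxGenEigenspace z).map (LinearMap.range P).subtype := by
  rw [rootSpace, ← Module.End.iSup_genEigenspace_eq, Submodule.map_iSup]
  simp_rw [hP.kerPow_eq_map h, Module.End.genEigenspace_nat]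

theorem finrank_rootSpace (hP : IsReducing S P) (h : InjMod S P z) :
    Module.finrank ℂ (rootSpace S z) = Module.finrank ℂ (hP.part.maxGenEigenspace z) := by
  rw [hP.rootSpace_eq_map h]
  exact Submodule.finrank_map_subtype_eq _ _

theorem finiteDimensional_rootSpace (hP : IsReducing S P) [FiniteDimensional ℂ (LinearMap.range P)]
    (h : InjMod S P z) : FiniteDimensional ℂ (rootSpace S z) := by
  rw [hP.rootSpace_eq_map h]
  infer_instance

theorem mem_eigenspace_of_hasEigenvector (hP : IsReducing S P) {x : LinearMap.range P}
    (h : hP.part.HasEigenvector z x) : (x : H) ∈ NormalPerturbation.eigenspace S z := by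
  refine mem_eigenspace_iff.mpr ⟨hP.range_le x.2, ?_⟩
  rw [← hP.coe_part_apply, h.apply_eq_smul]
  rfl

theorem isEigenvalue_of_hasEigenvalue (hP : IsReducing S P) (h : hP.part.HasEigenvalue z) :
    IsEigenvalue S z := by
  obtain ⟨x, hx⟩ := h.exists_hasEigenvector
  intro hbot
  have h1 := hP.mem_eigenspace_of_hasEigenvector hx
  rw [hbot, Submodule.mem_bot] at h1
  exact hx.2 (Subtype.ext h1)

theorem mem_spec_of_isEigenvalue (h : IsEigenvalue S z) : z ∈ spec S := by
  intro hb
  obtain ⟨x, hx, hx0⟩ := Submodule.exists_mem_ne_zero_of_ne_bot h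
  obtain ⟨hxS, hx⟩ := mem_eigenspace_iff.mp hx
  have h1 : shift S z ⟨x, hxS⟩ = shift S z 0 := by
    rw [map_zero, shift_apply, hx, sub_self]
  exact hx0 (congrArg Subtype.val (hb.1 h1))

/-- In the finite-dimensional range of `P`, injectivity of `S - z` gives surjectivity; modulo that
range `S - z` is bijective by assumption. -/
theorem mem_spec_iff (hP : IsReducing S P) [FiniteDimensional ℂ (LinearMap.range P)]
    (h : InjMod S P z) (h' : SurjMod S P z) : z ∈ spec S ↔ hP.part.HasEigenvalue z := by
  refine ⟨fun hz => ?_, fun hz => mem_spec_of_isEigenvalue (hP.isEigenvalue_of_hasEigenvalue hz)⟩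
  by_contra hne
  have hker : LinearMap.ker (hP.part - z • 1) = ⊥ := by
    rw [← Module.End.eigenspace_def]
    exact not_not.mp (Module.End.hasEigenvalue_iff.not.mp hne)
  have hsurj : Function.Surjective
      (hP.part - z • 1 : Module.End ℂ (LinearMap.range P)) :=
    LinearMap.injective_iff_surjective.mp (LinearMap.ker_eq_bot.mp hker)
  have hcoe (x : LinearMap.range P) :
      (((hP.part - z • 1) x : LinearMap.range P) : H) = shift S z ⟨x, hP.range_le x.2⟩ := by
    simp [coe_part_apply, shift_apply]
  refine hz ⟨?_, fun y => ?_⟩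
  · rw [← LinearMap.ker_eq_bot, LinearMap.ker_eq_bot']
    intro x hx
    have hPx := h x hx
    have hmem : (x : H) ∈ LinearMap.range P := ⟨x, hPx⟩
    have h1 : (⟨x, hmem⟩ : LinearMap.range P) ∈ LinearMap.ker (hP.part - z • 1) := by
      rw [LinearMap.mem_ker]
      refine Subtype.ext ?_
      rw [hcoe]
      exact hx
    rw [hker, Submodule.mem_bot] at h1
    exact Subtype.ext (congrArg (Subtype.val : LinearMap.range P → H) h1)
  · obtain ⟨x, hx⟩ := h' y
    obtain ⟨v, hv⟩ := hsurj ⟨P y, y, rfl⟩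
    refine ⟨x + ⟨v, hP.range_le v.2⟩, ?_⟩
    rw [map_add, hx, ← hcoe, hv]
    simp

/-- If `S - z` is bijective modulo the range of `P` for `z` in `U`, and the part of `S` in the
range of `P` has all its eigenvalues in `U`, then the algebraic multiplicities of the spectral
points in `U` add up to the rank of `P`. -/
theorem hasTotalAlgMult (hP : IsReducing S P) [FiniteDimensional ℂ (LinearMap.range P)] {U : Set ℂ}
    (hinj : ∀ z ∈ U, InjMod S P z) (hsurj : ∀ z ∈ U, SurjMod S P z)
    (hU : ∀ z, hP.part.HasEigenvalue z → z ∈ U) :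
    HasTotalAlgMult S U (Module.finrank ℂ (LinearMap.range P)) := by
  have hfin : {z | hP.part.HasEigenvalue z}.Finite := by
    simp_rw [Module.End.hasEigenvalue_iff_mem_spectrum]
    exact Module.End.finite_spectrum _
  have hmem {z : ℂ} : z ∈ hfin.toFinset ↔ hP.part.HasEigenvalue z := by simp
  refine ⟨hfin.toFinset, ?_, fun z hz => ⟨hP.isEigenvalue_of_hasEigenvalue (hmem.mp hz),
    hP.finiteDimensional_rootSpace (hinj z (hU z (hmem.mp hz)))⟩, ?_⟩
  · ext z
    rw [Finset.mem_coe, hmem]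
    exact ⟨fun h => ⟨(hP.mem_spec_iff (hinj z (hU z h)) (hsurj z (hU z h))).mpr h, hU z h⟩,
      fun h => (hP.mem_spec_iff (hinj z h.2) (hsurj z h.2)).mp h.1⟩
  · rw [Finset.sum_congr rfl fun z hz => hP.finrank_rootSpace (hinj z (hU z (hmem.mp hz)))]
    -- Over `ℂ` the range of `P` is the direct sum of the generalized eigenspaces of the part, so
    -- their dimensions add up to the rank.
    have hind : iSupIndep fun z : hfin.toFinset => hP.part.maxGenEigenspace z :=
      (Module.End.independent_maxGenEigenspace hP.part).comp Subtype.val_injective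
    have htop : ⨆ z : hfin.toFinset, hP.part.maxGenEigenspace z = ⊤ := by
      rw [eq_top_iff, ← Module.End.iSup_maxGenEigenspace_eq_top hP.part]
      refine iSup_le fun z => ?_
      by_cases hz : hP.part.HasEigenvalue z
      · exact le_iSup (fun z : hfin.toFinset => hP.part.maxGenEigenspace z) ⟨z, hmem.mpr hz⟩
      · have hbot : hP.part.maxGenEigenspace z = ⊥ := by
          by_contra hne
          exact hz (Module.End.HasUnifEigenvalue.lt zero_lt_one hne)
        rw [hbot]
        exact bot_le
    have hint := DirectSum.isInternal_submodule_of_iSupIndep_of_iSup_eq_top hind htop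
    have e := LinearEquiv.ofBijective (DirectSum.coeLinearMap _) hint
    rw [← e.finrank_eq, Module.finrank_directSum, ← Finset.sum_coe_sort]

end IsReducing

end Decomposition

/-! ### The rank of a Riesz projection counts algebraic multiplicities. -/

section Riesz

variable {H : Type*} [NormedAddCommGroup H] [InnerProductSpace ℂ H] [CompleteSpace H]
  {S : H →ₗ.[ℂ] H} {R C : H →L[ℂ] H} {c : ℂ} {r s : ℝ}

/-- Writing the projection as `P = RX` places its range in `D(S) = ran R`, and `CXR = PC` says `S P
(R u) = P S (R u)`. -/
theorem IsPencil.isReducing (hp : IsPencil S R C) (hs : 0 < s) (hsr : s < r)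
    (h : ∀ z ∈ closedBall c r, z ∉ ball c s → IsUnit (C - z • R)) :
    IsReducing S (rieszProj R C c r).toLinearMap := by
  have hr : 0 < r := hs.trans hsr
  have hsph : ∀ z ∈ sphere c r, IsUnit (C - z • R) := fun z hz =>
    h z (sphere_subset_closedBall hz) (by rw [mem_sphere] at hz; simp [hz, hsr.le])
  obtain ⟨X, hX, hcomm, -⟩ := exists_rieszProj_factor hr.le hsph
  have hval (x : H) : rieszProj R C c r x = R (X x) := by rw [hX]; rfl
  have hdom (x : H) : rieszProj R C c r x ∈ S.domain := by
    rw [hval]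
    exact hp.mem_domain _
  refine ⟨hdom, fun x => ?_, fun x => ?_⟩
  · exact congrArg (fun P : H →L[ℂ] H => P x) (rieszProj_mul_self hs hsr h)
  · obtain ⟨x, hx⟩ := x
    obtain ⟨u, rfl⟩ := (hp.2.1 x).mp hx
    rw [hp.2.2]
    have h1 : (⟨rieszProj R C c r (R u), hdom (R u)⟩ : S.domain) =
        ⟨R (X (R u)), hp.mem_domain _⟩ := Subtype.ext (hval _)
    have h2 := congrArg (fun P : H →L[ℂ] H => P u) hcomm
    simp only [mul_apply_eq_comp] at h2
    simp only [ContinuousLinearMap.coe_coe]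
    rw [h1, hp.2.2, h2]

/-- The algebraic multiplicities of the spectral points of `S` inside a circle add up to the rank
of the Riesz projection of that circle. -/
theorem IsPencil.hasTotalAlgMult (hp : IsPencil S R C) (hs : 0 ≤ s) (hsr : s < r)
    (h : ∀ z ∈ closedBall c r, z ∉ closedBall c s → IsUnit (C - z • R))
    [FiniteDimensional ℂ (LinearMap.range (rieszProj R C c r).toLinearMap)] :
    HasTotalAlgMult S (closedBall c s)
      (Module.finrank ℂ (LinearMap.range (rieszProj R C c r).toLinearMap)) := by
  have hr : 0 < r := hs.trans_lt hsr
  have hsph : ∀ z ∈ sphere c r, IsUnit (C - z • R) := fun z hz =>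
    h z (sphere_subset_closedBall hz) (by rw [mem_sphere] at hz; simp [hz, hsr])
  have hP : IsReducing S (rieszProj R C c r).toLinearMap := by
    refine hp.isReducing (s := (s + r) / 2) (by linarith) (by linarith) fun z hz hz' => h z hz ?_
    intro h'
    rw [mem_ball] at hz'
    rw [mem_closedBall] at h'
    linarith
  have hball : closedBall c s ⊆ ball c r := closedBall_subset_ball hsr
  refine hP.hasTotalAlgMult ?_ ?_ ?_
  · intro z hz x hx
    obtain ⟨Y, -, hY⟩ := exists_inverse_mod_rieszProj hr.le hsph (hball hz)
    obtain ⟨x, hxS⟩ := x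
    obtain ⟨u, rfl⟩ := (hp.2.1 x).mp hxS
    rw [hp.shift_apply] at hx
    have h1 := congrArg (fun P : H →L[ℂ] H => P u) hY
    simp only [mul_apply_eq_comp, hx, map_zero, sub_apply, one_apply_eq_self] at h1
    exact (sub_eq_zero.mp h1.symm).symm
  · intro z hz y
    obtain ⟨Y, hY, -⟩ := exists_inverse_mod_rieszProj hr.le hsph (hball hz)
    refine ⟨⟨R (Y y), hp.mem_domain _⟩, ?_⟩
    rw [hp.shift_apply]
    exact congrArg (fun P : H →L[ℂ] H => P y) hY
  · intro z hz
    obtain ⟨x, hx⟩ := hz.exists_hasEigenvector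
    have hxe := hP.mem_eigenspace_of_hasEigenvector hx
    have hspec : z ∈ spec S :=
      IsReducing.mem_spec_of_isEigenvalue (hP.isEigenvalue_of_hasEigenvalue hz)
    -- An eigenvalue of the part outside the small disk cannot lie in the regular annulus. Beyond
    -- the large circle, `P` annihilates its eigenvector, yet that vector lies in the range of `P`.
    by_contra hzs
    by_cases hzr : z ∈ closedBall c r
    · exact hspec (hp.mem_resolventSet_iff.mpr (h z hzr hzs))
    · have h1 := hp.rieszProj_apply_of_eigen_of_not_mem_closedBall hr.le hsph hxe hzr
      have h2 : rieszProj R C c r (x : H) = x := hP.apply_eq x.2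
      exact hx.2 (Subtype.ext (h2.symm.trans h1))

end Riesz

/-! ### Stability of the rank of an idempotent. -/

section Rank

variable {H : Type*} [NormedAddCommGroup H] [NormedSpace ℂ H]

/-- `P` is injective on the range of `Q`: if `x = Qx` and `Px = 0`, then `(P - Q)x = -x`, which
forces `x = 0` since `‖P - Q‖ < 1`. -/
theorem rank_range_le_of_norm_sub_lt_one {P Q : H →L[ℂ] H} (hQ : Q * Q = Q) (h : ‖P - Q‖ < 1) :
    Module.rank ℂ (LinearMap.range (Q : H →ₗ[ℂ] H)) ≤
      Module.rank ℂ (LinearMap.range (P : H →ₗ[ℂ] H)) := by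
  let f : LinearMap.range (Q : H →ₗ[ℂ] H) →ₗ[ℂ] LinearMap.range (P : H →ₗ[ℂ] H) :=
    (P : H →ₗ[ℂ] H).rangeRestrict ∘ₗ Submodule.subtype _
  refine LinearMap.rank_le_of_injective f ?_
  rw [← LinearMap.ker_eq_bot, LinearMap.ker_eq_bot']
  rintro ⟨_, y, rfl⟩ hx
  have h1 : P (Q y) = 0 := congrArg Subtype.val hx
  have h2 : Q (Q y) = Q y := congrArg (fun A : H →L[ℂ] H => A y) hQ
  refine Subtype.ext ?_
  by_contra hne
  have h3 : (P - Q) (Q y) = -(Q y) := by simp [h1, h2]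
  have h4 := (P - Q).le_opNorm (Q y)
  rw [h3, norm_neg] at h4
  have h5 : 0 < ‖Q y‖ := norm_pos_iff.mpr hne
  nlinarith

theorem rank_range_eq_of_norm_sub_lt_one {P Q : H →L[ℂ] H} (hP : P * P = P) (hQ : Q * Q = Q)
    (h : ‖P - Q‖ < 1) :
    Module.rank ℂ (LinearMap.range (Q : H →ₗ[ℂ] H)) =
      Module.rank ℂ (LinearMap.range (P : H →ₗ[ℂ] H)) :=
  le_antisymm (rank_range_le_of_norm_sub_lt_one hQ h)
    (rank_range_le_of_norm_sub_lt_one hP (norm_sub_rev P Q ▸ h))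

/-- The rank is constant along a continuous family of idempotents. -/
theorem rank_range_eq_of_continuous {X : Type*} [TopologicalSpace X] [PreconnectedSpace X]
    {P : X → H →L[ℂ] H} (hc : Continuous P) (hP : ∀ x, P x * P x = P x) (x y : X) :
    Module.rank ℂ (LinearMap.range (P x : H →ₗ[ℂ] H)) =
      Module.rank ℂ (LinearMap.range (P y : H →ₗ[ℂ] H)) := by
  have hloc : IsLocallyConstant fun x => Module.rank ℂ (LinearMap.range (P x : H →ₗ[ℂ] H)) := by
    refine (IsLocallyConstant.iff_eventually_eq _).mpr fun x => ?_
    filter_upwards [hc.continuousAt.eventually (Metric.ball_mem_nhds (P x) one_pos)] with y hy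
    refine rank_range_eq_of_norm_sub_lt_one (hP x) (hP y) ?_
    rwa [dist_comm, dist_eq_norm] at hy
  exact hloc.apply_eq_of_preconnectedSpace x y

end Rank

/-! ### Products of unbounded operators. -/

section Product

variable {H : Type*} [NormedAddCommGroup H] [InnerProductSpace ℂ H]

theorem mem_prod_domain_iff {S R : H →ₗ.[ℂ] H} {x : H} :
    x ∈ (prod S R).domain ↔ ∃ h : x ∈ R.domain, R ⟨x, h⟩ ∈ S.domain := by
  change x ∈ ((S.domain.comap R.toFun).map R.domain.subtype) ⊓ R.domain ↔ _
  simp only [Submodule.mem_inf, Submodule.mem_map, Submodule.mem_comap]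
  constructor
  · rintro ⟨⟨y, hy, rfl⟩, -⟩
    exact ⟨y.2, hy⟩
  · rintro ⟨h, h'⟩
    exact ⟨⟨⟨x, h⟩, h', rfl⟩, h⟩

theorem prod_apply {S R : H →ₗ.[ℂ] H} {x : H} (hx : x ∈ (prod S R).domain)
    (h : x ∈ R.domain) (h' : R ⟨x, h⟩ ∈ S.domain) :
    prod S R ⟨x, hx⟩ = S ⟨R ⟨x, h⟩, h'⟩ := rfl

theorem linearPMap_congr {S R : H →ₗ.[ℂ] H} (h : S = R) {x : H} (hS : x ∈ S.domain)
    (hR : x ∈ R.domain) : S ⟨x, hS⟩ = R ⟨x, hR⟩ := by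
  subst h
  rfl

end Product

/-! ### Resolvents of normal operators are normal. -/

section Normal

variable {H : Type*} [NormedAddCommGroup H] [InnerProductSpace ℂ H] [CompleteSpace H]
  {T : H →ₗ.[ℂ] H} {z : ℂ}

/-- The resolvent of a closed operator is bounded. -/
theorem exists_isPencil_of_mem_resolventSet (hT : T.IsClosed) (hz : z ∈ resolventSet T) :
    ∃ R : H →L[ℂ] H, IsPencil T R (1 + z • R) := by
  let e := LinearEquiv.ofBijective (shift T z) hz
  let R₀ : H →ₗ[ℂ] H := T.domain.subtype ∘ₗ e.symm.toLinearMap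
  have hmem (u : H) : R₀ u ∈ T.domain := (e.symm u).2
  have hval (u : H) (h : R₀ u ∈ T.domain) : T ⟨R₀ u, h⟩ = u + z • R₀ u := by
    have h1 : e (e.symm u) = u := e.apply_symm_apply u
    have h2 : T (e.symm u) - z • (e.symm u : H) = u := h1
    exact sub_eq_iff_eq_add.mp h2
  -- The inverse has a closed graph because `T` does, so the closed graph theorem bounds it.
  have hgraph : ∀ (u : ℕ → H) (x y), Filter.Tendsto u Filter.atTop (nhds x) →
      Filter.Tendsto (R₀ ∘ u) Filter.atTop (nhds y) → y = R₀ x := by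
    intro u x y hu hR
    have h1 : Filter.Tendsto (fun n => (R₀ (u n), u n + z • R₀ (u n))) Filter.atTop
        (nhds (y, x + z • y)) := hR.prodMk_nhds (hu.add (hR.const_smul z))
    have h2 : (y, x + z • y) ∈ (T.graph : Set (H × H)) := by
      refine hT.mem_of_tendsto h1 (Filter.Eventually.of_forall fun n => ?_)
      exact T.mem_graph_iff.mpr ⟨⟨_, hmem (u n)⟩, rfl, hval _ _⟩
    obtain ⟨w, hw, hw'⟩ := T.mem_graph_iff.mp h2
    simp only at hw hw'
    have h3 : e w = x := by
      change T w - z • (w : H) = x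
      rw [hw', hw, add_sub_cancel_right]
    rw [← h3, ← hw]
    change _ = ((e.symm (e w) : T.domain) : H)
    rw [e.symm_apply_apply]
  let R : H →L[ℂ] H := ⟨R₀, R₀.continuous_of_seq_closed_graph hgraph⟩
  refine ⟨R, ?_, fun x => ⟨fun hx => ⟨e ⟨x, hx⟩, ?_⟩, ?_⟩, fun u h => ?_⟩
  · exact Subtype.val_injective.comp e.symm.injective
  · change ((e.symm (e ⟨x, hx⟩) : T.domain) : H) = x
    rw [e.symm_apply_apply]
  · rintro ⟨u, rfl⟩
    exact hmem u
  · exact hval u h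

open scoped LinearPMap InnerProductSpace

theorem IsNormal.apply_adjoint_apply (hT : IsNormal T) {x : H} (hx : x ∈ T.domain)
    (hTx : T ⟨x, hx⟩ ∈ T†.domain) :
    ∃ (hx' : x ∈ T†.domain) (h : T† ⟨x, hx'⟩ ∈ T.domain),
      T ⟨T† ⟨x, hx'⟩, h⟩ = T† ⟨T ⟨x, hx⟩, hTx⟩ := by
  have h1 : x ∈ (prod T† T).domain := mem_prod_domain_iff.mpr ⟨hx, hTx⟩
  have h2 : x ∈ (prod T T†).domain := by rw [hT.2.2]; exact h1
  obtain ⟨hx', h⟩ := mem_prod_domain_iff.mp h2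
  refine ⟨hx', h, ?_⟩
  rw [← prod_apply h2, ← prod_apply h1]
  exact linearPMap_congr hT.2.2 h2 h1

/-- On `D(T*T)` one has `‖T*x‖² = ⟨x, TT*x⟩ = ⟨x, T*Tx⟩ = ‖Tx‖²`. -/
theorem IsNormal.norm_adjoint_apply (hT : IsNormal T) {x : H} (hx : x ∈ T.domain)
    (hx' : x ∈ T†.domain) (hTx : T ⟨x, hx⟩ ∈ T†.domain) : ‖T† ⟨x, hx'⟩‖ = ‖T ⟨x, hx⟩‖ := by
  obtain ⟨hx'', h, e⟩ := hT.apply_adjoint_apply hx hTx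
  have hadj := LinearPMap.adjoint_isFormalAdjoint hT.2.1
  have h1 := hadj ⟨x, hx'⟩ ⟨_, h⟩
  have h2 := hadj ⟨_, hTx⟩ ⟨x, hx⟩
  simp only at h1 h2
  rw [e] at h1
  have h3 : ⟪x, T† ⟨T ⟨x, hx⟩, hTx⟩⟫_ℂ = ⟪T ⟨x, hx⟩, T ⟨x, hx⟩⟫_ℂ := by
    rw [← inner_conj_symm, h2, inner_conj_symm]
  rw [h3, inner_self_eq_norm_sq_to_K, inner_self_eq_norm_sq_to_K] at h1
  have h4 : ‖T† ⟨x, hx'⟩‖ ^ 2 = ‖T ⟨x, hx⟩‖ ^ 2 := by exact_mod_cast h1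
  exact (sq_eq_sq₀ (norm_nonneg _) (norm_nonneg _)).mp h4

/-- The domain of a normal operator with nonempty resolvent set is contained in the domain of its
adjoint. -/
theorem IsNormal.domain_le_adjoint_domain (hT : IsNormal T) {R : H →L[ℂ] H}
    (hp : IsPencil T R (1 + z • R)) : T.domain ≤ T†.domain := by
  have hadj := LinearPMap.adjoint_isFormalAdjoint hT.2.1
  obtain ⟨C, hC⟩ : ∃ C : H →L[ℂ] H, C = 1 + z • R := ⟨_, rfl⟩
  rw [← hC] at hp
  -- `W` represents the graph inner product of `T` pulled back along `R`; solving `W u = R* y`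
  -- amounts to `R u = (1 + T*T)⁻¹ y`. Such `u` are dense, and for them `R u ∈ D(T*T)`.
  let W : H →L[ℂ] H := star R * R + star C * C
  have hW (u v : H) : ⟪v, W u⟫_ℂ = ⟪R v, R u⟫_ℂ + ⟪C v, C u⟫_ℂ := by
    simp only [W, ContinuousLinearMap.star_eq_adjoint, add_apply, mul_apply_eq_comp,
      inner_add_right, ContinuousLinearMap.adjoint_inner_right]
  have hWunit : IsUnit W := by
    -- The coercivity constant comes from `u = Cu - zRu` and Cauchy–Schwarz.
    have hc : (0 : ℝ) < (1 + ‖z‖ ^ 2)⁻¹ := by positivity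
    refine ContinuousLinearMap.isUnit_of_forall_le_norm_inner_map W
      (c := ⟨(1 + ‖z‖ ^ 2)⁻¹, hc.le⟩) hc fun u => ?_
    rw [← norm_inner_symm, hW]
    have h1 : ⟪R u, R u⟫_ℂ + ⟪C u, C u⟫_ℂ = ((‖R u‖ ^ 2 + ‖C u‖ ^ 2 : ℝ) : ℂ) := by
      rw [inner_self_eq_norm_sq_to_K, inner_self_eq_norm_sq_to_K]
      push_cast
      rfl
    rw [h1, Complex.norm_real, Real.norm_of_nonneg (by positivity)]
    change ‖u‖ ^ 2 * (1 + ‖z‖ ^ 2)⁻¹ ≤ _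
    rw [← div_eq_mul_inv, div_le_iff₀ (by positivity)]
    have h2 : ‖u‖ ≤ ‖C u‖ + ‖z‖ * ‖R u‖ := by
      have : u = C u - z • R u := by simp [hC]
      calc ‖u‖ = ‖C u - z • R u‖ := congrArg _ this
        _ ≤ ‖C u‖ + ‖z • R u‖ := norm_sub_le _ _
        _ = _ := by rw [norm_smul]
    have h3 := pow_le_pow_left₀ (norm_nonneg u) h2 2
    nlinarith [sq_nonneg (‖R u‖ - ‖z‖ * ‖C u‖)]
  have hdense : DenseRange fun y => Ring.inverse W (star R y) := by
    have h1 : DenseRange (star R : H →L[ℂ] H) := by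
      have h2 : (star R).toLinearMap.range.topologicalClosure = ⊤ := by
        rw [Submodule.topologicalClosure_eq_top_iff, ContinuousLinearMap.orthogonal_range,
          ContinuousLinearMap.star_eq_adjoint, ContinuousLinearMap.adjoint_adjoint]
        exact LinearMap.ker_eq_bot.mpr hp.1
      exact (Submodule.dense_iff_topologicalClosure_eq_top.mpr h2)
    have h3 : Function.Surjective (Ring.inverse W : H →L[ℂ] H) := fun y => ⟨W y, by
      rw [← mul_apply_eq_comp, Ring.inverse_mul_cancel _ hWunit]
      rfl⟩
    exact h3.denseRange.comp h1 (Ring.inverse W).continuous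
  -- For `x = R u` in `D(T*T)` this is `|⟨T*x, R v⟩| ≤ ‖Tx‖ ‖R v‖`. Both sides are continuous in
  -- `u`, so it extends to all of `D(T)` and makes `⟨x, T ·⟩` a bounded functional there.
  have hbound (v u : H) : ‖⟪R u, C v⟫_ℂ‖ ≤ ‖C u‖ * ‖R v‖ := by
    refine hdense.induction_on (p := fun u => ‖⟪R u, C v⟫_ℂ‖ ≤ ‖C u‖ * ‖R v‖) u
      (isClosed_le (by fun_prop) (by fun_prop)) fun y => ?_
    set u := Ring.inverse W (star R y) with hu
    have hWu : W u = star R y := by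
      rw [hu, ← mul_apply_eq_comp, Ring.mul_inverse_cancel _ hWunit]
      rfl
    have hx := hp.mem_domain u
    have hTx : T ⟨R u, hx⟩ ∈ T†.domain := by
      refine LinearPMap.mem_adjoint_domain_of_exists _ ⟨y - R u, ?_⟩
      rintro ⟨w, hw⟩
      obtain ⟨w, rfl⟩ := (hp.2.1 w).mp hw
      have h1 := hW u w
      rw [hWu, ContinuousLinearMap.star_eq_adjoint,
        ContinuousLinearMap.adjoint_inner_right] at h1
      rw [hp.2.2, hp.2.2, ← inner_conj_symm, inner_sub_right, h1, add_sub_cancel_left,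
        inner_conj_symm]
    obtain ⟨hx', -, -⟩ := hT.apply_adjoint_apply hx hTx
    have h2 := hadj ⟨R u, hx'⟩ ⟨R v, hp.mem_domain v⟩
    rw [hp.2.2] at h2
    simp only at h2
    rw [← h2, ← hp.2.2 u hx, ← hT.norm_adjoint_apply hx hx' hTx]
    exact norm_inner_le_norm _ _
  intro x hx
  obtain ⟨u, rfl⟩ := (hp.2.1 x).mp hx
  rw [LinearPMap.mem_adjoint_domain_iff]
  refine AddMonoidHomClass.continuous_of_bound _ ‖C u‖ ?_
  rintro ⟨w, hw⟩
  obtain ⟨v, rfl⟩ := (hp.2.1 w).mp hw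
  have h1 := hbound v u
  rw [← hp.2.2 v hw] at h1
  exact h1

/-- For `x = R R* y`, normality gives `(T - z)(T* - z̄)x = y`, so `R y = (T* - z̄)x`. Applying `R*`
returns `R* R y = x`. -/
theorem IsNormal.isStarNormal_resolvent (hT : IsNormal T) {R : H →L[ℂ] H}
    (hp : IsPencil T R (1 + z • R)) : IsStarNormal R := by
  have hadj := LinearPMap.adjoint_isFormalAdjoint hT.2.1
  have hle := hT.domain_le_adjoint_domain hp
  have hTR (u : H) (h : R u ∈ T.domain) : T ⟨R u, h⟩ = u + z • R u := hp.2.2 u _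
  have hex (y : H) (v : T.domain) :
      ⟪y + (starRingEnd ℂ) z • star R y, (v : H)⟫_ℂ = ⟪star R y, T v⟫_ℂ := by
    obtain ⟨v, hv⟩ := v
    obtain ⟨v, rfl⟩ := (hp.2.1 v).mp hv
    rw [hTR, ContinuousLinearMap.star_eq_adjoint, inner_add_left, inner_smul_left,
      inner_add_right, inner_smul_right, ContinuousLinearMap.adjoint_inner_left,
      ContinuousLinearMap.adjoint_inner_left]
    simp
  have hmem (y : H) : star R y ∈ T†.domain :=
    LinearPMap.mem_adjoint_domain_of_exists _ ⟨_, hex y⟩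
  have hTs (y : H) : T† ⟨star R y, hmem y⟩ = y + (starRingEnd ℂ) z • star R y :=
    LinearPMap.adjoint_apply_eq hT.2.1 _ (hex y)
  refine ⟨ContinuousLinearMap.ext fun y => ?_⟩
  simp only [mul_apply_eq_comp]
  set x := R (star R y) with hxdef
  have hx : x ∈ T.domain := hp.mem_domain _
  have hTx : T ⟨x, hx⟩ = star R y + z • x := hTR _ _
  have hTxm : T ⟨x, hx⟩ ∈ T†.domain := by
    rw [hTx]
    exact add_mem (hmem y) (Submodule.smul_mem _ _ (hle hx))
  obtain ⟨hx', hm, hcomm⟩ := hT.apply_adjoint_apply hx hTxm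
  have hTsTx : T† ⟨T ⟨x, hx⟩, hTxm⟩ =
      y + (starRingEnd ℂ) z • star R y + z • T† ⟨x, hx'⟩ := by
    have h1 : (⟨T ⟨x, hx⟩, hTxm⟩ : T†.domain) = ⟨star R y, hmem y⟩ + z • ⟨x, hx'⟩ :=
      Subtype.ext hTx
    rw [h1, LinearPMap.map_add, LinearPMap.map_smul, hTs]
  let p : T.domain := ⟨T† ⟨x, hx'⟩, hm⟩ - (starRingEnd ℂ) z • ⟨x, hx⟩
  have hpv : (p : H) = T† ⟨x, hx'⟩ - (starRingEnd ℂ) z • x := rfl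
  have hTp : T p = y + z • (p : H) := by
    rw [LinearPMap.map_sub, LinearPMap.map_smul, hcomm, hTsTx, hTx, hpv]
    module
  have hRy : R y = p := by
    obtain ⟨q, hq⟩ := (hp.2.1 p).mp p.2
    have h1 : p = ⟨R q, hp.mem_domain q⟩ := Subtype.ext hq.symm
    have h2 := hTp
    rw [h1, hTR] at h2
    rw [← hq, add_right_cancel h2]
  rw [hRy]
  refine ext_inner_right ℂ fun u => ?_
  rw [ContinuousLinearMap.star_eq_adjoint, ContinuousLinearMap.adjoint_inner_left, hpv,
    inner_sub_left, inner_smul_left, Complex.conj_conj]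
  have h2 := hadj ⟨x, hx'⟩ ⟨R u, hp.mem_domain u⟩
  simp only at h2
  rw [h2, hTR, inner_add_right, inner_smul_right, add_sub_cancel_right]

end Normal

/-! ### Functional calculus for the resolvent. -/

section Estimate

variable {H : Type*} [NormedAddCommGroup H] [InnerProductSpace ℂ H] [CompleteSpace H]

open scoped InnerProductSpace

/-- The left side is the quadratic form of `N = a² R*R + b² C*C` with `C = 1 + zR`. Since `N = f(R)`
for the normal operator `R`, its norm is at most the supremum of `f` over the spectrum. -/
theorem norm_sq_add_norm_sq_le_of_isStarNormal {R : H →L[ℂ] H} (hR : IsStarNormal R) {z : ℂ}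
    {a b M : ℝ} (hM0 : 0 ≤ M)
    (hM : ∀ μ ∈ spectrum ℂ R, a ^ 2 * ‖μ‖ ^ 2 + b ^ 2 * ‖1 + z * μ‖ ^ 2 ≤ M) (u : H) :
    a ^ 2 * ‖R u‖ ^ 2 + b ^ 2 * ‖u + z • R u‖ ^ 2 ≤ M * ‖u‖ ^ 2 := by
  let C : H →L[ℂ] H := 1 + z • R
  let N : H →L[ℂ] H := ((a : ℂ) ^ 2) • (star R * R) + ((b : ℂ) ^ 2) • (star C * C)
  let f : ℂ → ℂ := fun μ => (a : ℂ) ^ 2 * (star μ * μ) +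
    (b : ℂ) ^ 2 * (star (1 + z * μ) * (1 + z * μ))
  have hCf : cfc (fun μ : ℂ => 1 + z * μ) R = C := by
    rw [cfc_const_add .., cfc_const_mul_id ..]
    simp [C]
  have hN : cfc f R = N := by
    simp only [f]
    rw [cfc_add .., cfc_const_mul .., cfc_const_mul .., cfc_mul .., cfc_mul .., cfc_star_id ..,
      cfc_id' .., cfc_star, hCf]
  have hnorm : ‖N‖ ≤ M := by
    rw [← hN]
    refine norm_cfc_le hM0 fun μ hμ => ?_
    have h1 : f μ = ((a ^ 2 * ‖μ‖ ^ 2 + b ^ 2 * ‖1 + z * μ‖ ^ 2 : ℝ) : ℂ) := by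
      simp only [f, star_def, Complex.conj_mul']
      push_cast
      rfl
    rw [h1, Complex.norm_real, Real.norm_of_nonneg (by positivity)]
    exact hM μ hμ
  have hinner : ⟪u, N u⟫_ℂ = ((a ^ 2 * ‖R u‖ ^ 2 + b ^ 2 * ‖u + z • R u‖ ^ 2 : ℝ) : ℂ) := by
    have hCu : C u = u + z • R u := rfl
    simp only [N, ContinuousLinearMap.star_eq_adjoint, add_apply, smul_apply, mul_apply_eq_comp,
      inner_add_right, inner_smul_right, ContinuousLinearMap.adjoint_inner_right,
      inner_self_eq_norm_sq_to_K]
    rw [hCu]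
    push_cast
    rfl
  have h2 := norm_inner_le_norm (𝕜 := ℂ) u (N u)
  rw [hinner, Complex.norm_real, Real.norm_of_nonneg (by positivity)] at h2
  have h3 := N.le_opNorm u
  have h4 : ‖u‖ * ‖N u‖ ≤ ‖u‖ * (M * ‖u‖) := by gcongr; exact h3.trans (by gcongr)
  linarith [show ‖u‖ * (M * ‖u‖) = M * ‖u‖ ^ 2 by ring]

/-- The nonzero spectral points of the resolvent `(T - z)⁻¹` are the numbers `(w - z)⁻¹` with `w`
in the spectrum of `T`. -/
theorem IsPencil.exists_of_mem_spectrum {T : H →ₗ.[ℂ] H} {R : H →L[ℂ] H} {z : ℂ}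
    (hp : IsPencil T R (1 + z • R)) {μ : ℂ} (hμ : μ ∈ spectrum ℂ R) (hμ0 : μ ≠ 0) :
    ∃ w ∈ spec T, μ * (w - z) = 1 := by
  refine ⟨z + μ⁻¹, fun h => hμ ?_, by field_simp; ring⟩
  rw [hp.mem_resolventSet_iff] at h
  have h1 : algebraMap ℂ (H →L[ℂ] H) μ - R = μ • (1 + z • R - (z + μ⁻¹) • R) := by
    rw [Algebra.algebraMap_eq_smul_one, add_smul, smul_sub, smul_add, smul_add, smul_smul μ μ⁻¹,
      mul_inv_cancel₀ hμ0]
    module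
  rw [spectrum.mem_resolventSet_iff, h1]
  exact h.smul (Units.mk0 μ hμ0)

end Estimate

/-! ### Perturbed resolvents and invariance of the total multiplicity. -/

section Perturbation

variable {H : Type*} [NormedAddCommGroup H] [InnerProductSpace ℂ H]
  {T A : H →ₗ.[ℂ] H} {R C : H →L[ℂ] H} {a b : ℝ}

/-- A relatively bounded perturbation of `C R⁻¹` has the form `(C + B) R⁻¹`. -/
theorem IsPencil.exists_add (hp : IsPencil T R C) (hA : IsRelBounded T A a b) :
    ∃ B : H →L[ℂ] H, IsPencil (T + A) R (C + B) ∧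
      ∀ u, ‖B u‖ ^ 2 ≤ a ^ 2 * ‖R u‖ ^ 2 + b ^ 2 * ‖C u‖ ^ 2 := by
  obtain ⟨hle, hA⟩ := hA
  let B₀ : H →ₗ[ℂ] H := A.toFun ∘ₗ Submodule.inclusion hle ∘ₗ
    LinearMap.codRestrict T.domain (R : H →ₗ[ℂ] H) hp.mem_domain
  have hB₀ (u : H) : ‖B₀ u‖ ^ 2 ≤ a ^ 2 * ‖R u‖ ^ 2 + b ^ 2 * ‖C u‖ ^ 2 := by
    have h1 := hA ⟨R u, hp.mem_domain u⟩
    rw [hp.2.2] at h1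
    exact h1
  have hbound (u : H) : ‖B₀ u‖ ≤ (|a| * ‖R‖ + |b| * ‖C‖) * ‖u‖ := by
    have h1 : ‖B₀ u‖ ≤ |a| * ‖R u‖ + |b| * ‖C u‖ := by
      refine le_of_sq_le_sq ?_ (by positivity)
      have h2 : 0 ≤ (|a| * ‖R u‖) * (|b| * ‖C u‖) := by positivity
      nlinarith [hB₀ u, sq_abs a, sq_abs b]
    have h3 := mul_le_mul_of_nonneg_left (R.le_opNorm u) (abs_nonneg a)
    have h4 := mul_le_mul_of_nonneg_left (C.le_opNorm u) (abs_nonneg b)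
    linarith
  refine ⟨B₀.mkContinuous _ hbound, ⟨hp.1, fun x => ?_, fun u h => ?_⟩, hB₀⟩
  · rw [← hp.2.1]
    exact ⟨fun h => h.1, fun h => ⟨h, hle h⟩⟩
  · rw [add_apply, ← hp.2.2 u h.1]
    rfl

variable [CompleteSpace H]

/-- At `μ = (w - z)⁻¹` the function `f` below equals `(a² + b²|w|²)/|w - z|² < 1`, and at `μ = 0`,
which can be a spectral point of the resolvent, it equals `b² < 1`. Compactness of the spectrum
turns the pointwise inequality into a uniform one. -/
theorem IsNormal.exists_lt_one_bound (hT : IsNormal T) {z : ℂ} (hp : IsPencil T R (1 + z • R))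
    (hb : 0 ≤ b) (hb1 : b < 1)
    (h : ∀ w ∈ spec T, a ^ 2 + b ^ 2 * ‖w‖ ^ 2 < ‖w - z‖ ^ 2) :
    ∃ M, 0 ≤ M ∧ M < 1 ∧
      ∀ u, a ^ 2 * ‖R u‖ ^ 2 + b ^ 2 * ‖u + z • R u‖ ^ 2 ≤ M * ‖u‖ ^ 2 := by
  have hR := hT.isStarNormal_resolvent hp
  let f : ℂ → ℝ := fun μ => a ^ 2 * ‖μ‖ ^ 2 + b ^ 2 * ‖1 + z * μ‖ ^ 2
  have hf : ContinuousOn f (spectrum ℂ R) := by fun_prop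
  have hlt : ∀ μ ∈ spectrum ℂ R, f μ < 1 := by
    intro μ hμ
    rcases eq_or_ne μ 0 with rfl | hμ0
    · simp only [f, norm_zero, mul_zero, add_zero, norm_one]
      nlinarith
    · obtain ⟨w, hw, hwμ⟩ := hp.exists_of_mem_spectrum hμ hμ0
      have h1 : 1 + z * μ = μ * w := by rw [← hwμ]; ring
      have h2 : ‖μ‖ ^ 2 * ‖w - z‖ ^ 2 = 1 := by rw [← mul_pow, ← norm_mul, hwμ]; simp
      have h3 : 0 < ‖μ‖ ^ 2 := by positivity
      have h4 : f μ = ‖μ‖ ^ 2 * (a ^ 2 + b ^ 2 * ‖w‖ ^ 2) := by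
        simp only [f, h1, norm_mul]
        ring
      rw [h4, ← h2]
      exact mul_lt_mul_of_pos_left (h w hw) h3
  rcases (spectrum ℂ R).eq_empty_or_nonempty with hemp | hne
  · refine ⟨0, le_rfl, one_pos, norm_sq_add_norm_sq_le_of_isStarNormal hR le_rfl ?_⟩
    simp [hemp]
  · obtain ⟨μ₀, hμ₀, hmax⟩ := (spectrum.isCompact R).exists_isMaxOn hne hf
    have h0 : 0 ≤ f μ₀ := by positivity
    exact ⟨f μ₀, h0, hlt μ₀ hμ₀, norm_sq_add_norm_sq_le_of_isStarNormal hR h0 hmax⟩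

/-- The resolvent at `z` obtained from the resolvent at another point. -/
theorem IsPencil.isPencil_pencilRes (hp : IsPencil T R C) {z : ℂ} (hz : IsUnit (C - z • R)) :
    IsPencil T (pencilRes R C z) (1 + z • pencilRes R C z) := by
  have hinv (u : H) : Ring.inverse (C - z • R) ((C - z • R) u) = u := by
    rw [← mul_apply_eq_comp, Ring.inverse_mul_cancel _ hz]
    rfl
  have hinv' (u : H) : (C - z • R) (Ring.inverse (C - z • R) u) = u := by
    rw [← mul_apply_eq_comp, Ring.mul_inverse_cancel _ hz]
    rfl
  refine ⟨fun u v huv => ?_, fun x => ?_, fun u h => ?_⟩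
  · have h1 : Ring.inverse (C - z • R) u = Ring.inverse (C - z • R) v := hp.1 huv
    rw [← hinv' u, h1, hinv']
  · rw [hp.2.1]
    constructor
    · rintro ⟨u, rfl⟩
      exact ⟨(C - z • R) u, congrArg R (hinv u)⟩
    · rintro ⟨u, rfl⟩
      exact ⟨_, rfl⟩
  · have h1 := hp.2.2 (Ring.inverse (C - z • R) u) h
    refine h1.trans ?_
    have h2 := hinv' u
    simp only [sub_apply, smul_apply] at h2
    exact sub_eq_iff_eq_add.mp h2

/-- With `G = (C - zR)⁻¹` the pencil factors as `(1 + tBG)(C - zR)`, and `‖BG‖ ≤ √M < 1`. Allowing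
every `|t| ≤ 1` provides the homotopy from `T` to `T + A`. -/
theorem IsNormal.isUnit_pencil_add (hT : IsNormal T) (hp : IsPencil T R C) {B : H →L[ℂ] H}
    (hB : ∀ u, ‖B u‖ ^ 2 ≤ a ^ 2 * ‖R u‖ ^ 2 + b ^ 2 * ‖C u‖ ^ 2)
    (hb : 0 ≤ b) (hb1 : b < 1) {z : ℂ}
    (h : ∀ w ∈ spec T, a ^ 2 + b ^ 2 * ‖w‖ ^ 2 < ‖w - z‖ ^ 2) {t : ℂ} (ht : ‖t‖ ≤ 1) :
    IsUnit (C + t • B - z • R) := by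
  have hz : IsUnit (C - z • R) := by
    rw [← hp.mem_resolventSet_iff]
    by_contra hzs
    have := h z hzs
    simp only [sub_self, norm_zero] at this
    nlinarith [sq_nonneg a, sq_nonneg (b * ‖z‖)]
  obtain ⟨M, hM0, hM1, hM⟩ := hT.exists_lt_one_bound (hp.isPencil_pencilRes hz) hb hb1 h
  set G := Ring.inverse (C - z • R) with hG
  have hnorm : ‖t • (B * G)‖ < 1 := by
    have h1 : ‖B * G‖ ≤ √M := by
      refine ContinuousLinearMap.opNorm_le_bound _ (Real.sqrt_nonneg _) fun y => ?_
      refine le_of_sq_le_sq ?_ (by positivity)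
      rw [mul_pow, Real.sq_sqrt hM0]
      refine le_trans ?_ (hM y)
      refine (hB (G y)).trans (le_of_eq ?_)
      have h2 : C (G y) = y + z • R (G y) := by
        have h3 : (C - z • R) (G y) = y := by
          rw [← mul_apply_eq_comp, hG, Ring.mul_inverse_cancel _ hz]
          rfl
        simp only [sub_apply, smul_apply] at h3
        exact sub_eq_iff_eq_add.mp h3
      rw [h2]
      rfl
    rw [norm_smul]
    have h2 : √M < 1 := by rw [Real.sqrt_lt' one_pos]; simpa using hM1
    calc ‖t‖ * ‖B * G‖ ≤ 1 * √M := by gcongr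
      _ < 1 := by rwa [one_mul]
  have h1 : IsUnit (1 + t • (B * G)) := by
    have := isUnit_one_sub_of_norm_lt_one (x := -(t • (B * G))) (by rwa [norm_neg])
    rwa [sub_neg_eq_add] at this
  have h2 : C + t • B - z • R = (1 + t • (B * G)) * (C - z • R) := by
    rw [add_mul, one_mul, smul_mul_assoc, mul_assoc, hG, Ring.inverse_mul_cancel _ hz, mul_one]
    abel
  rw [h2]
  exact h1.mul hz

theorem IsNormal.norm_resolvent_le (hT : IsNormal T) {z : ℂ} (hp : IsPencil T R (1 + z • R))
    {δ : ℝ} (hδ : 0 < δ) (h : ∀ w ∈ spec T, δ ≤ ‖w - z‖) : ‖R‖ ≤ δ⁻¹ := by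
  refine ContinuousLinearMap.opNorm_le_bound _ (by positivity) fun u => ?_
  have h1 := norm_sq_add_norm_sq_le_of_isStarNormal (hT.isStarNormal_resolvent hp) (z := z)
    (a := 1) (b := 0) (M := (δ⁻¹) ^ 2) (by positivity) ?_ u
  · refine le_of_sq_le_sq ?_ (by positivity)
    rw [mul_pow]
    simpa using h1
  · intro μ hμ
    rcases eq_or_ne μ 0 with rfl | hμ0
    · simp only [norm_zero]
      norm_num
      positivity
    · obtain ⟨w, hw, hwμ⟩ := hp.exists_of_mem_spectrum hμ hμ0
      have h2 : ‖μ‖ * ‖w - z‖ = 1 := by rw [← norm_mul, hwμ, norm_one]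
      have h3 : ‖μ‖ ≤ δ⁻¹ := by
        rw [eq_inv_of_mul_eq_one_left h2]
        exact inv_anti₀ hδ (h w hw)
      have h4 := pow_le_pow_left₀ (norm_nonneg μ) h3 2
      simpa using h4

/-- For an isolated spectral point of a normal operator the Riesz projection maps onto the
eigenspace. -/
theorem IsNormal.range_rieszProj (hT : IsNormal T) (hp : IsPencil T R C) {k : ℂ} {r : ℝ}
    (hr : 0 < r) (h : spec T ∩ closedBall k r ⊆ {k}) :
    LinearMap.range (rieszProj R C k r).toLinearMap = eigenspace T k := by
  have hunit : ∀ z ∈ closedBall k r, z ≠ k → IsUnit (C - z • R) := by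
    intro z hz hzk
    rw [← hp.mem_resolventSet_iff]
    by_contra hzs
    exact hzk (h ⟨hzs, hz⟩)
  have hsph : ∀ z ∈ sphere k r, IsUnit (C - z • R) := fun z hz =>
    hunit z (sphere_subset_closedBall hz) (ne_of_mem_sphere hz hr.ne')
  refine le_antisymm ?_ fun x hx => ⟨x, ?_⟩
  · obtain ⟨X, hX, -, hX'⟩ := exists_rieszProj_factor hr.le hsph
    -- `(C - kR)X` represents `(T - k)P`, the integral of `(w - k)(T - w)⁻¹` up to a factor. Shrink
    -- the circle to radius `δ`: the integrand has norm at most 1, so the normalized integral is at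
    -- most `δ`. Taking `δ ≤ r/2` keeps all spectral points at distance at least `δ` from the
    -- circle.
    have hzero : (C - k • R) * X = 0 := by
      have hsmall : ∀ δ : ℝ, 0 < δ → δ ≤ r / 2 → ‖(C - k • R) * X‖ ≤ δ := by
        intro δ hδ hδr
        have hann : (∮ w in C(k, r), (w - k) • pencilRes R C w) =
            ∮ w in C(k, δ), (w - k) • pencilRes R C w := by
          have hu : ∀ z ∈ closedBall k r, z ∉ ball k δ → IsUnit (C - z • R) :=
            fun z hz hz' => hunit z hz fun e => hz' (e ▸ mem_ball_self hδ)
          refine circleIntegral_eq_of_differentiable_on_annulus_off_countable hδ (by linarith)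
            countable_empty ?_ ?_
          · have hc : ContinuousOn (pencilRes R C) (closedBall k r \ ball k δ) :=
              continuousOn_pencilRes fun z hz => hu z hz.1 hz.2
            fun_prop
          · rintro z ⟨⟨hz1, hz2⟩, -⟩
            have hd : DifferentiableAt ℂ (pencilRes R C) z := differentiableAt_pencilRes
              (hu z (ball_subset_closedBall hz1) fun h' => hz2 (ball_subset_closedBall h'))
            fun_prop
        rw [hX' k, norm_neg, hann]
        have := circleIntegral.norm_two_pi_i_inv_smul_integral_le_of_norm_le_const (C := 1)
          (f := fun w => (w - k) • pencilRes R C w) (c := k) hδ.le ?_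
        · simpa using this
        · intro w hw
          have hwδ : ‖w - k‖ = δ := by simpa [dist_eq_norm] using hw
          have hu : IsUnit (C - w • R) := by
            refine hunit w ?_ (ne_of_mem_sphere hw hδ.ne')
            rw [mem_closedBall, dist_eq_norm]
            linarith
          have h1 := hT.norm_resolvent_le (hp.isPencil_pencilRes hu) hδ fun v hv => ?_
          · rw [norm_smul, hwδ]
            calc δ * ‖_‖ ≤ δ * δ⁻¹ := by gcongr
              _ = 1 := mul_inv_cancel₀ hδ.ne'
          · by_cases hvr : v ∈ closedBall k r
            · rw [h ⟨hv, hvr⟩, norm_sub_rev, hwδ]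
            · rw [mem_closedBall, dist_eq_norm, not_le] at hvr
              have := norm_sub_le_norm_sub_add_norm_sub v w k
              linarith
      rw [← norm_le_zero_iff]
      refine le_of_forall_pos_le_add fun ε hε => ?_
      rw [zero_add]
      exact (hsmall (min ε (r / 2)) (by positivity) (min_le_right _ _)).trans (min_le_left _ _)
    rintro _ ⟨y, rfl⟩
    have hval : (rieszProj R C k r).toLinearMap y = R (X y) := by
      change rieszProj R C k r y = _
      rw [hX]
      rfl
    rw [hval, mem_eigenspace_iff]
    refine ⟨hp.mem_domain _, ?_⟩
    rw [hp.2.2]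
    have h1 := congrArg (fun P : H →L[ℂ] H => P y) hzero
    simp only [mul_apply_eq_comp, sub_apply, smul_apply, zero_apply] at h1
    exact sub_eq_zero.mp h1
  · exact hp.rieszProj_apply_of_eigen_of_mem_ball hr.le hsph hx (mem_ball_self hr)

/-- A relatively bounded perturbation of a normal operator keeps the total algebraic multiplicity
inside a circle around an isolated eigenvalue, provided the circle stays in the resolvent set. -/
theorem IsNormal.hasTotalAlgMult_add (hT : IsNormal T) (hA : IsRelBounded T A a b)
    (hb : 0 ≤ b) (hb1 : b < 1) {k : ℂ} {r s : ℝ} (hs : 0 ≤ s) (hsr : s < r)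
    (hk : spec T ∩ closedBall k r ⊆ {k})
    (h : ∀ z ∈ closedBall k r, z ∉ closedBall k s →
      ∀ w ∈ spec T, a ^ 2 + b ^ 2 * ‖w‖ ^ 2 < ‖w - z‖ ^ 2)
    (hfin : FiniteDimensional ℂ (eigenspace T k)) :
    HasTotalAlgMult (T + A) (closedBall k s) (Module.finrank ℂ (eigenspace T k)) := by
  have hr : 0 < r := hs.trans_lt hsr
  -- Any regular point can serve as base point for the pencil; this one lies on the circle.
  have hz₀ : k + r ∈ resolventSet T := by
    by_contra hz
    have h1 : k + r ∈ closedBall k r := by simp [abs_of_pos hr]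
    have h2 : k + r = k := hk ⟨hz, h1⟩
    simp [hr.ne'] at h2
  obtain ⟨R, hp⟩ := exists_isPencil_of_mem_resolventSet hT.1 hz₀
  obtain ⟨C, hC⟩ : ∃ C : H →L[ℂ] H, C = 1 + (k + r) • R := ⟨_, rfl⟩
  rw [← hC] at hp
  obtain ⟨B, hpB, hB⟩ := hp.exists_add hA
  have hunit (t : unitInterval) : ∀ z ∈ closedBall k r, z ∉ closedBall k s →
      IsUnit (C + ((t : ℝ) : ℂ) • B - z • R) := fun z hz hz' =>
    hT.isUnit_pencil_add hp hB hb hb1 (h z hz hz')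
      (by rw [Complex.norm_real, Real.norm_of_nonneg t.2.1]; exact t.2.2)
  have hnot : ∀ z ∈ sphere k r, z ∉ closedBall k s := fun z hz => by
    rw [mem_sphere] at hz
    simp [hz, hsr]
  have hcont : Continuous fun t : unitInterval =>
      rieszProj R (C + ((t : ℝ) : ℂ) • B) k r :=
    continuous_rieszProj (by fun_prop) hr.le fun t z hz =>
      hunit t z (sphere_subset_closedBall hz) (hnot z hz)
  have hidem (t : unitInterval) : rieszProj R (C + ((t : ℝ) : ℂ) • B) k r *
      rieszProj R (C + ((t : ℝ) : ℂ) • B) k r = rieszProj R (C + ((t : ℝ) : ℂ) • B) k r := by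
    refine rieszProj_mul_self (s := (s + r) / 2) (by linarith) (by linarith) fun z hz hz' =>
      hunit t z hz fun h' => hz' ?_
    rw [mem_closedBall] at h'
    rw [mem_ball]
    linarith
  have hrank := rank_range_eq_of_continuous hcont hidem 1 0
  rw [show C + (((1 : unitInterval) : ℝ) : ℂ) • B = C + B by simp,
    show C + (((0 : unitInterval) : ℝ) : ℂ) • B = C by simp] at hrank
  rw [hT.range_rieszProj hp hr hk] at hrank
  have hfin' : FiniteDimensional ℂ (LinearMap.range (rieszProj R (C + B) k r).toLinearMap) := by
    rw [FiniteDimensional, ← Module.rank_lt_aleph0_iff, hrank]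
    exact Module.rank_lt_aleph0_iff.mpr hfin
  have h1 := hpB.hasTotalAlgMult hs hsr fun z hz hz' => by simpa using hunit 1 z hz hz'
  rwa [Module.finrank, hrank] at h1

end Perturbation

/-! ### Geometry of the regions. -/

section Region

variable {a b α β γ₁ γ₂ : ℝ}

/-- The function whose graph bounds `Hyp`. -/
def hypBound (a b γ x : ℝ) : ℝ :=
  √((a ^ 2 + b ^ 2 * γ ^ 2) / (1 - b ^ 2) + b ^ 2 * x ^ 2 / (1 - b ^ 2))

theorem mem_Hyp_iff {γ : ℝ} {z : ℂ} : z ∈ Hyp a b γ ↔ hypBound a b γ z.re < z.im := by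
  constructor
  · rintro ⟨h1, h2⟩
    exact (Real.sqrt_lt' h2).mpr h1
  · intro h
    have h2 : 0 < z.im := (Real.sqrt_nonneg _).trans_lt h
    exact ⟨(Real.sqrt_lt' h2).mp h, h2⟩

theorem mem_hypRegion_iff {z : ℂ} : z ∈ hypRegion a b γ₁ γ₂ ↔
    z.im < γ₁ - hypBound a b (gammaTilde γ₁ γ₂) z.re ∨
      γ₂ + hypBound a b (gammaTilde γ₁ γ₂) z.re < z.im := by
  have heven (x : ℝ) : hypBound a b (gammaTilde γ₁ γ₂) (-x) =
      hypBound a b (gammaTilde γ₁ γ₂) x := by simp [hypBound]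
  refine or_congr ⟨?_, fun h => ⟨I * γ₁ - z, ?_, by simp⟩⟩ ⟨?_, fun h => ⟨z - I * γ₂, ?_, by simp⟩⟩
  · rintro ⟨w, hw, rfl⟩
    rw [mem_Hyp_iff] at hw
    simp [heven]
    linarith
  · rw [mem_Hyp_iff]
    simp [heven]
    linarith
  · rintro ⟨w, hw, rfl⟩
    rw [mem_Hyp_iff] at hw
    simp
    linarith
  · rw [mem_Hyp_iff]
    simp
    linarith

/-- With `d = √(c + b²α²)` the difference of the two sides is `(α - x)((1 - b²)(α - x) + 2(b²α +
d))`, and `d ≥ b|α| ≥ -b²α`. Thus `x + √(c + b²x²)` over `x ≤ α` is largest at `x = α`, which yields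
`α'`. -/
theorem add_sq_le_shift_sq {c x : ℝ} (hc : 0 ≤ c) (hb : 0 ≤ b) (hb1 : b < 1) (hx : x ≤ α) :
    c + b ^ 2 * x ^ 2 ≤ (α - x + √(c + b ^ 2 * α ^ 2)) ^ 2 := by
  set d := √(c + b ^ 2 * α ^ 2) with hd
  have hd2 : d ^ 2 = c + b ^ 2 * α ^ 2 := Real.sq_sqrt (by positivity)
  have hdα : b * |α| ≤ d := by
    refine Real.le_sqrt_of_sq_le ?_
    rw [mul_pow, sq_abs]
    linarith
  have h1 : b ^ 2 * |α| ≤ d := by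
    have := mul_le_of_le_one_left (mul_nonneg hb (abs_nonneg α)) hb1.le
    linarith [show b ^ 2 * |α| = b * (b * |α|) by ring]
  have h2 : -(b ^ 2 * α) ≤ b ^ 2 * |α| := by nlinarith [neg_abs_le α, sq_nonneg b]
  have h3 : 0 ≤ (α - x) * ((1 - b ^ 2) * (α - x) + 2 * (b ^ 2 * α + d)) := by
    have h4 : 0 ≤ 1 - b ^ 2 := by nlinarith
    have h5 : 0 ≤ b ^ 2 * α + d := by linarith
    have h6 : 0 ≤ α - x := by linarith
    positivity
  nlinarith

/-- The minimum of `(x - u)² - b²x²` over `x` is `-b²u²/(1 - b²)`, attained at `x = u/(1 - b²)`;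
moreover `c ≤ c/(1 - b²)`. -/
theorem add_sq_lt_of_hyp {c x u v : ℝ} (hc : 0 ≤ c) (hb : 0 ≤ b) (hb1 : b < 1)
    (h : c / (1 - b ^ 2) + b ^ 2 * u ^ 2 / (1 - b ^ 2) < v ^ 2) :
    c + b ^ 2 * x ^ 2 < (x - u) ^ 2 + v ^ 2 := by
  have he : 0 < 1 - b ^ 2 := by nlinarith
  rw [← add_div, div_lt_iff₀ he] at h
  have h1 : 0 < (1 - b ^ 2) * ((x - u) ^ 2 + v ^ 2 - (c + b ^ 2 * x ^ 2)) := by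
    nlinarith [sq_nonneg ((1 - b ^ 2) * x - u), mul_nonneg (sq_nonneg b) hc]
  have h2 := (mul_pos_iff_of_pos_left he).mp h1
  linarith

/-- Points of `openRegion` are far away from the gapped strip. -/
theorem add_norm_sq_lt_of_mem_openRegion (hb : 0 ≤ b) (hb1 : b < 1) {z w : ℂ}
    (hz : z ∈ openRegion a b α β γ₁ γ₂) (hw : w ∈ Str α β γ₁ γ₂) :
    a ^ 2 + b ^ 2 * ‖w‖ ^ 2 < ‖w - z‖ ^ 2 := by
  obtain ⟨hwre, hw1, hw2⟩ := hw
  set c := a ^ 2 + b ^ 2 * gammaTilde γ₁ γ₂ ^ 2 with hc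
  have hc0 : 0 ≤ c := by positivity
  have him : w.im ^ 2 ≤ gammaTilde γ₁ γ₂ ^ 2 := by
    rw [← sq_abs w.im]
    exact pow_le_pow_left₀ (abs_nonneg _) (abs_le_max_abs_abs hw1 hw2) 2
  have hle : a ^ 2 + b ^ 2 * ‖w‖ ^ 2 ≤ c + b ^ 2 * w.re ^ 2 := by
    rw [Complex.sq_norm, Complex.normSq_apply]
    nlinarith [mul_le_mul_of_nonneg_left him (sq_nonneg b)]
  have hnorm : ‖w - z‖ ^ 2 = (w.re - z.re) ^ 2 + (w.im - z.im) ^ 2 := by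
    rw [Complex.sq_norm, Complex.normSq_apply]
    simp only [sub_re, sub_im]
    ring
  rw [hnorm]
  refine hle.trans_lt ?_
  rcases hz with ⟨hz1, hz2⟩ | hz
  · have hcase : w.re ≤ α ∨ β ≤ w.re := by
      by_contra! h
      exact hwre h
    refine lt_of_lt_of_le ?_ (le_add_of_nonneg_right (sq_nonneg _))
    rw [alphaPrime, ← hc] at hz1
    rw [betaPrime, ← hc] at hz2
    rcases hcase with h | h
    · refine (add_sq_le_shift_sq hc0 hb hb1 h).trans_lt ?_
      rw [← neg_sub z.re, neg_sq]
      refine pow_lt_pow_left₀ (by linarith) ?_ two_ne_zero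
      have := Real.sqrt_nonneg (c + b ^ 2 * α ^ 2)
      linarith
    -- The right edge of the gap follows from the left one by the reflection `x ↦ -x`.
    · have h1 := add_sq_le_shift_sq hc0 hb hb1 (neg_le_neg h)
      rw [neg_sq, neg_sq] at h1
      refine h1.trans_lt ?_
      refine pow_lt_pow_left₀ (by linarith) ?_ two_ne_zero
      have := Real.sqrt_nonneg (c + b ^ 2 * β ^ 2)
      linarith
  · rcases hz with ⟨v, ⟨hv, hv0⟩, rfl⟩ | ⟨v, ⟨hv, hv0⟩, rfl⟩
    · rw [← hc] at hv
      have hv' : c / (1 - b ^ 2) + b ^ 2 * (-v.re) ^ 2 / (1 - b ^ 2) < v.im ^ 2 := by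
        rwa [neg_sq]
      -- Since `Im w ≥ γ₁`, the vertical distance from `w` to `iγ₁ - v` is at least `Im v`.
      refine (add_sq_lt_of_hyp (x := w.re) hc0 hb hb1 hv').trans_le ?_
      simp
      nlinarith
    · rw [← hc] at hv
      refine (add_sq_lt_of_hyp (x := w.re) hc0 hb hb1 hv).trans_le ?_
      simp
      nlinarith

theorem continuous_hypBound {γ : ℝ} : Continuous (hypBound a b γ) := by
  unfold hypBound
  fun_prop

/-- Through a point outside `hypRegion` runs a curve outside `hypRegion` that is parametrized by
the real part. -/
theorem exists_curve_not_mem_hypRegion (hγ : γ₁ ≤ γ₂) {z : ℂ} (hz : z ∉ hypRegion a b γ₁ γ₂) :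
    ∃ p : ℝ → ℂ, Continuous p ∧ p z.re = z ∧ ∀ x, (p x).re = x ∧ p x ∉ hypRegion a b γ₁ γ₂ := by
  let h : ℝ → ℝ := hypBound a b (gammaTilde γ₁ γ₂)
  have hh : Continuous h := continuous_hypBound
  have hh0 (x : ℝ) : 0 ≤ h x := Real.sqrt_nonneg _
  -- Follow the horizontal line through `z`, clamped between the two hyperbola branches.
  let y : ℝ → ℝ := fun x => max (γ₁ - h x) (min (γ₂ + h x) z.im)
  have hy : Continuous y := by fun_prop
  rw [mem_hypRegion_iff, not_or, not_lt, not_lt] at hz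
  refine ⟨fun x => (x : ℂ) + y x * I, by fun_prop, ?_, fun x => ⟨by simp, ?_⟩⟩
  · have h1 : y z.re = z.im := by
      simp only [y]
      rw [min_eq_right hz.2, max_eq_right hz.1]
    simp only [h1, re_add_im]
  · rw [mem_hypRegion_iff, not_or, not_lt, not_lt]
    simp only [add_re, ofReal_re, mul_re, I_re, mul_zero, ofReal_im, I_im, mul_one, sub_self,
      add_zero, add_im, mul_im, zero_add]
    refine ⟨le_max_left _ _, max_le ?_ (min_le_left _ _)⟩
    have := hh0 x
    change γ₁ - h x ≤ γ₂ + h x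
    linarith

/-- Only `Re z = α'` or `Re z = β'` outside the hyperbolic regions could fail. Moving a little along
the curve in both directions stays in `O` and outside those regions, so smaller and larger real
parts still lie in `[α', β']`; hence both inequalities are strict at `z`. -/
theorem subset_openRegion_of_isOpen (hγ : γ₁ ≤ γ₂) {O : Set ℂ} (hO : IsOpen O)
    (h : O ⊆ closedRegion a b α β γ₁ γ₂) : O ⊆ openRegion a b α β γ₁ γ₂ := by
  intro z hz
  by_contra hzU
  have hzh : z ∉ hypRegion a b γ₁ γ₂ := fun h' => hzU (Or.inr h')
  obtain ⟨p, hp, hpz, hpx⟩ := exists_curve_not_mem_hypRegion hγ hzh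
  have hmem {x : ℝ} (hx : p x ∈ O) :
      alphaPrime a b α γ₁ γ₂ ≤ x ∧ x ≤ betaPrime a b β γ₁ γ₂ := by
    rcases h hx with h' | h'
    · rwa [mem_ofPred_eq, (hpx x).1] at h'
    · exact absurd h' (hpx x).2
  have hnhds : ∀ᶠ x in nhds z.re, p x ∈ O :=
    hp.continuousAt.eventually (by rw [hpz]; exact hO.mem_nhds hz)
  obtain ⟨x₁, hx₁, hx₁'⟩ := (hnhds.filter_mono nhdsWithin_le_nhds |>.and
    (self_mem_nhdsWithin : Iio z.re ∈ nhdsWithin z.re (Iio z.re))).exists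
  obtain ⟨x₂, hx₂, hx₂'⟩ := (hnhds.filter_mono nhdsWithin_le_nhds |>.and
    (self_mem_nhdsWithin : Ioi z.re ∈ nhdsWithin z.re (Ioi z.re))).exists
  exact hzU (Or.inl ⟨(hmem hx₁).1.trans_lt hx₁', lt_of_lt_of_le hx₂' (hmem hx₂).2⟩)

end Region

/-! ### Additivity over disjoint sets. -/

section Union

variable {H : Type*} [NormedAddCommGroup H] [InnerProductSpace ℂ H]

theorem HasTotalAlgMult.biUnion {S : H →ₗ.[ℂ] H} {ι : Type*} {s : Finset ι} {K : ι → Set ℂ}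
    {m : ι → ℕ} (hK : (s : Set ι).PairwiseDisjoint K) (h : ∀ i ∈ s, HasTotalAlgMult S (K i) (m i)) :
    HasTotalAlgMult S (⋃ i ∈ s, K i) (∑ i ∈ s, m i) := by
  classical
  choose! F hF using h
  refine ⟨s.biUnion F, ?_, ?_, ?_⟩
  · rw [Finset.coe_biUnion, inter_iUnion₂]
    exact iUnion₂_congr fun i hi => (hF i hi).1
  · intro μ hμ
    obtain ⟨i, hi, hμi⟩ := Finset.mem_biUnion.mp hμ
    exact (hF i hi).2.1 μ hμi
  · rw [Finset.sum_biUnion]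
    · exact Finset.sum_congr rfl fun i hi => (hF i hi).2.2
    · intro i hi j hj hij
      rw [Function.onFun, ← Finset.disjoint_coe, (hF i hi).1, (hF j hj).1]
      exact (hK hi hj hij).mono inter_subset_right inter_subset_right

end Union

end NormalPerturbation

end

/-! ### The main theorem. -/

open NormalPerturbation in
theorem mainTheorem6 {H : Type*} [NormedAddCommGroup H] [InnerProductSpace ℂ H] [CompleteSpace H]
    (T A : H →ₗ.[ℂ] H) (hT : IsNormal T)
    (a b : ℝ) (ha : 0 ≤ a) (hb : 0 ≤ b) (hb1 : b < 1) (hA : IsRelBounded T A a b)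
    (α β γ₁ γ₂ : ℝ) (hαβ : α < β) (hγ : γ₁ ≤ γ₂)
    (S0 : Set ℂ) (S1 : Finset ℂ)
    (hspec : spec T = S0 ∪ (S1 : Set ℂ))
    (hS0 : S0 ⊆ Str α β γ₁ γ₂)
    (hS1 : Disjoint (S1 : Set ℂ) (Str α β γ₁ γ₂))
    (heig : ∀ w ∈ S1, IsEigenvalue T w ∧ FiniteDimensional ℂ (eigenspace T w)) :
    (openRegion a b α β γ₁ γ₂ \ ⋃ w ∈ S1, Metric.closedBall w (rad a b w)
        ⊆ resolventSet (T + A)) ∧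
    (∀ k ∈ S1, ∀ ε : ℝ, 0 < ε →
      Metric.closedBall k (rad a b k + 2 * ε) ⊆
        closedRegion a b α β γ₁ γ₂ \ ⋃ w ∈ S1.erase k, Metric.closedBall w (rad a b w) →
      HasTotalAlgMult (T + A) (Metric.closedBall k (rad a b k))
        (Module.finrank ℂ (eigenspace T k))) ∧
    (∀ ε : ℝ, 0 < ε →
      (∀ k ∈ S1, Metric.closedBall k (rad a b k + 2 * ε) ⊆
        closedRegion a b α β γ₁ γ₂ \ ⋃ w ∈ S1.erase k, Metric.closedBall w (rad a b w)) →
      HasTotalAlgMult (T + A) (⋃ w ∈ S1, Metric.closedBall w (rad a b w))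
        (∑ w ∈ S1, Module.finrank ℂ (eigenspace T w))) := by
  have hball {z w : ℂ} (h : z ∉ Metric.closedBall w (rad a b w)) :
      a ^ 2 + b ^ 2 * ‖w‖ ^ 2 < ‖w - z‖ ^ 2 := by
    rw [Metric.mem_closedBall, not_le, dist_comm, dist_eq_norm] at h
    exact (Real.sqrt_lt' ((Real.sqrt_nonneg _).trans_lt h)).mp h
  have hmult : ∀ k ∈ S1, ∀ ε : ℝ, 0 < ε →
      Metric.closedBall k (rad a b k + 2 * ε) ⊆
        closedRegion a b α β γ₁ γ₂ \ ⋃ w ∈ S1.erase k, Metric.closedBall w (rad a b w) →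
      HasTotalAlgMult (T + A) (Metric.closedBall k (rad a b k))
        (Module.finrank ℂ (eigenspace T k)) := by
    intro k hk ε hε hsub
    have hrad : 0 ≤ rad a b k := Real.sqrt_nonneg _
    have hU : Metric.ball k (rad a b k + 2 * ε) ⊆ openRegion a b α β γ₁ γ₂ :=
      subset_openRegion_of_isOpen hγ Metric.isOpen_ball fun z hz =>
        (hsub (Metric.ball_subset_closedBall hz)).1
    -- The contour has radius `r_k + ε`; the second `ε` leaves an open disk around it, where `V` may
    -- be replaced by `U`.
    have hin : Metric.closedBall k (rad a b k + ε) ⊆ Metric.ball k (rad a b k + 2 * ε) :=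
      Metric.closedBall_subset_ball (by linarith)
    have hne : ∀ z ∈ Metric.closedBall k (rad a b k + ε), ∀ w ∈ spec T, w ≠ k →
        a ^ 2 + b ^ 2 * ‖w‖ ^ 2 < ‖w - z‖ ^ 2 := by
      intro z hz w hw hwk
      rw [hspec] at hw
      rcases hw with hw | hw
      · exact add_norm_sq_lt_of_mem_openRegion hb hb1 (hU (hin hz)) (hS0 hw)
      · refine hball fun hzw => (hsub (Metric.ball_subset_closedBall (hin hz))).2 ?_
        exact Set.mem_iUnion₂.mpr ⟨w, Finset.mem_erase.mpr ⟨hwk, hw⟩, hzw⟩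
    refine hT.hasTotalAlgMult_add hA hb hb1 (r := rad a b k + ε) hrad (by linarith) ?_ ?_
      (heig k hk).2
    · rintro w ⟨hw, hwk⟩
      -- Another spectral point `w` in the disk would satisfy the distance inequality with `z = w`,
      -- whose right side is zero; so `k` is isolated.
      by_contra h
      have h1 := hne w hwk w hw h
      rw [sub_self, norm_zero] at h1
      nlinarith [sq_nonneg a, sq_nonneg (b * ‖w‖)]
    · intro z hz hz' w hw
      by_cases hwk : w = k
      · subst hwk
        exact hball hz'
      · exact hne z hz w hw hwk
  refine ⟨?_, hmult, ?_⟩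
  · rintro z ⟨hzU, hz⟩
    have hlt : ∀ w ∈ spec T, a ^ 2 + b ^ 2 * ‖w‖ ^ 2 < ‖w - z‖ ^ 2 := by
      intro w hw
      rw [hspec] at hw
      rcases hw with hw | hw
      · exact add_norm_sq_lt_of_mem_openRegion hb hb1 hzU (hS0 hw)
      · exact hball fun hzw => hz (Set.mem_iUnion₂.mpr ⟨w, hw, hzw⟩)
    have hzT : z ∈ resolventSet T := by
      by_contra hzs
      have h1 := hlt z hzs
      rw [sub_self, norm_zero] at h1
      nlinarith [sq_nonneg a, sq_nonneg (b * ‖z‖)]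
    obtain ⟨R, hp⟩ := exists_isPencil_of_mem_resolventSet hT.1 hzT
    obtain ⟨B, hpB, hB⟩ := hp.exists_add hA
    rw [hpB.mem_resolventSet_iff]
    simpa using hT.isUnit_pencil_add hp hB hb hb1 hlt (t := 1) (by simp)
  · intro ε hε h
    refine HasTotalAlgMult.biUnion ?_ fun k hk => hmult k hk ε hε (h k hk)
    intro k hk j hj hkj
    refine Set.disjoint_left.mpr fun z hz hz' => ?_
    have h1 := (h k hk (Metric.closedBall_subset_closedBall (by linarith) hz)).2
    exact h1 (Set.mem_iUnion₂.mpr ⟨j, Finset.mem_erase.mpr ⟨hkj.symm, hj⟩, hz'⟩)
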